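/- A partition is a weakly decreasing sequence of nonnegative integers with finitely many nonzero terms, identified with its Young diagram (the empty partition is allowed); $|\lambda|$ is the number of boxes of $\lambda$, and $\subset$ is containment of diagrams. For partitions $\mu,\nu,\lambda$, the Littlewood--Richardson coefficient $c_{\mu,\nu}^{\lambda}$ is the number of semistandard fillings, by positive integers, of the skew shape $\lambda/\mu$ having content $\nu$ and whose row reading word (rows read right to left, from top to bottom) is ballot, i.e. every initial segment contains at least as many letters $i$ as letters $i+1$, for all $i\ge 1$; it is $0$ if $\mu\not\subseteq\lambda$. The Newell--Littlewood number is $$N_{\mu,\nu,\lambda}=\sum_{\alpha,\beta,\gamma} c_{\alpha,\beta}^{\mu}\,c_{\alpha,\gamma}^{\nu}\,c_{\beta,\gamma}^{\lambda},$$ the sum being over all triples of partitions (only finitely many terms are nonzero). Let $\mu\Delta\nu=(\mu\setminus\nu)\cup(\nu\setminus\mu)$ be the symmetric difference of the diagrams. **Theorem.** Fix partitions $\mu$ and $\nu$. (I) For every integer $k\ge 0$, there exists a partition $\lambda$ with $|\lambda|=k$ and $N_{\mu,\nu,\lambda}>0$ if and only if $k\equiv|\mu\Delta\nu| \pmod 2$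 and $|\mu\Delta\nu|\le k\le|\mu|+|\nu|$. (II) If $N_{\mu,\nu,\lambda}>0$ and $|\lambda|>|\mu\Delta\nu|$, then there exists a partition $\lambda^{\downarrow\downarrow}\subset\lambda$ with $|\lambda^{\downarrow\downarrow}|=|\lambda|-2$ and $N_{\mu,\nu,\lambda^{\downarrow\downarrow}}>0$. (III) If $N_{\mu,\nu,\lambda}>0$ and $|\lambda|<|\mu|+|\nu|$, then there exists a partition $\lambda^{\uparrow\uparrow}\supset\lambda$ with $|\lambda^{\uparrow\uparrow}|=|\lambda|+2$ and $N_{\mu,\nu,\lambda^{\uparrow\uparrow}}>0$. -/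

import Mathlib

/-- Semistandard fillings of the skew shape `outer / inner`, where `inner ⊆ outer`. As in Mathlib's
`SemistandardYoungTableau`, a filling is a function on all pairs (row, column), both counted from
`0`; it takes positive values on the boxes of the skew shape and `0` elsewhere. -/
@[ext]
structure SkewTableau (outer inner : YoungDiagram) where
  /-- The entry in row `i` and column `j`. -/
  entry : ℕ → ℕ → ℕ
  /-- The skew shape exists. -/
  inner_le : inner ≤ outer
  /-- Entries are positive on the skew shape. -/
  pos : ∀ i j : ℕ, (i, j) ∈ outer → (i, j) ∉ inner → 0 < entry i j
  /-- Rows are weakly increasing from left to right. -/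
  row_weak : ∀ i j₁ j₂ : ℕ, j₁ < j₂ → (i, j₁) ∉ inner → (i, j₂) ∈ outer →
    entry i j₁ ≤ entry i j₂
  /-- Columns are strictly increasing from top to bottom. -/
  col_strict : ∀ i₁ i₂ j : ℕ, i₁ < i₂ → (i₁, j) ∉ inner → (i₂, j) ∈ outer →
    entry i₁ j < entry i₂ j
  /-- Entries outside the skew shape are `0`. -/
  zeros : ∀ i j : ℕ, (i, j) ∉ outer ∨ (i, j) ∈ inner → entry i j = 0

namespace SkewTableau

variable {outer inner : YoungDiagram}

/-- The number of boxes of the skew shape whose entry is `k`. -/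
def content (T : SkewTableau outer inner) (k : ℕ) : ℕ :=
  ((outer.cells \ inner.cells).filter fun c => T.entry c.1 c.2 = k).card

/-- The row reading word: each row is read from right to left, rows from top to bottom. -/
def rowWord (T : SkewTableau outer inner) : List ℕ :=
  (List.range (outer.colLen 0)).flatMap fun i =>
    (List.range' (inner.rowLen i) (outer.rowLen i - inner.rowLen i)).reverse.map (T.entry i)

end SkewTableau

/-- A word in the positive integers is ballot if every initial segment contains at least as many
letters `i` as letters `i + 1`, for all `i ≥ 1`. -/
def IsBallot (w : List ℕ) : Prop :=
  ∀ i k : ℕ, 1 ≤ i → (w.take k).count (i + 1) ≤ (w.take k).count i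

/-- Littlewood-Richardson tableaux: ballot semistandard tableaux of shape `lam / μ` and content `ν`
(the letter `i + 1` occurs as often as there are boxes in the row of `ν` with index `i`,
rows being indexed from `0`). -/
def LRTableau (μ ν lam : YoungDiagram) : Type :=
  {T : SkewTableau lam μ // (∀ i, T.content (i + 1) = ν.rowLen i) ∧ IsBallot T.rowWord}

/-- The Littlewood-Richardson coefficient `c_{μ,ν}^{lam}`. -/
noncomputable def lrCoeff (μ ν lam : YoungDiagram) : ℕ :=
  Nat.card (LRTableau μ ν lam)

/-- The summand of the Newell-Littlewood number indexed by `(α, β, γ)`. -/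
noncomputable def nlTerm (μ ν lam : YoungDiagram)
    (t : YoungDiagram × YoungDiagram × YoungDiagram) : ℕ :=
  lrCoeff t.1 t.2.1 μ * lrCoeff t.1 t.2.2 ν * lrCoeff t.2.1 t.2.2 lam

/-- The Newell-Littlewood number: the sum of `c_{α,β}^μ c_{α,γ}^ν c_{β,γ}^{lam}` over all triples
of partitions `(α, β, γ)`. Only finitely many terms are nonzero, see `nlTerm_support_finite`. -/
noncomputable def newellLittlewood (μ ν lam : YoungDiagram) : ℕ :=
  ∑ᶠ t : YoungDiagram × YoungDiagram × YoungDiagram, nlTerm μ ν lam t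

theorem LRTableau.entry_le {μ ν lam : YoungDiagram} (T : LRTableau μ ν lam) (i j : ℕ) :
    T.1.entry i j ≤ ν.colLen 0 := by
  by_contra! h
  obtain ⟨k, hk⟩ : ∃ k, T.1.entry i j = k + 1 := ⟨T.1.entry i j - 1, by omega⟩
  have hin : (i, j) ∈ lam ∧ (i, j) ∉ μ := by
    by_contra hn
    have := T.1.zeros i j (by tauto)
    omega
  have hpos : 0 < T.1.content (k + 1) := by
    refine Finset.card_pos.2 ⟨(i, j), ?_⟩
    simp [hin.1, hin.2, hk]
  rw [T.2.1 k] at hpos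
  have h1 : (k, 0) ∈ ν := YoungDiagram.mem_iff_lt_rowLen.2 hpos
  have h2 := YoungDiagram.mem_iff_lt_colLen.1 h1
  omega

/-- There are finitely many Littlewood-Richardson tableaux, so `lrCoeff` really counts them. -/
instance LRTableau.finite (μ ν lam : YoungDiagram) : Finite (LRTableau μ ν lam) := by
  let F : LRTableau μ ν lam → (lam.cells → Fin (ν.colLen 0 + 1)) := fun T c =>
    ⟨T.1.entry c.1.1 c.1.2, Nat.lt_succ_of_le (T.entry_le _ _)⟩
  refine Finite.of_injective F fun S T h => Subtype.ext (SkewTableau.ext ?_)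
  funext i j
  by_cases hc : (i, j) ∈ lam
  · have := congrFun h ⟨(i, j), hc⟩
    simpa [F] using this
  · rw [S.1.zeros i j (Or.inl hc), T.1.zeros i j (Or.inl hc)]

theorem finite_card_le (n : ℕ) : {μ : YoungDiagram | μ.card ≤ n}.Finite := by
  refine Set.Finite.of_finite_image (f := YoungDiagram.cells)
    (((Finset.range n ×ˢ Finset.range n).powerset.finite_toSet).subset ?_) ?_
  · rintro _ ⟨μ, hμ, rfl⟩
    simp only [Finset.coe_powerset, Set.mem_preimage, Set.mem_powerset_iff, Finset.coe_subset]
    rintro ⟨i, j⟩ hc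
    have hc' : (i, j) ∈ μ := hc
    have h1 : (μ.row i).card ≤ μ.card := Finset.card_le_card (Finset.filter_subset _ _)
    have h2 : (μ.col j).card ≤ μ.card := Finset.card_le_card (Finset.filter_subset _ _)
    rw [← YoungDiagram.rowLen_eq_card] at h1
    rw [← YoungDiagram.colLen_eq_card] at h2
    have h3 := YoungDiagram.mem_iff_lt_rowLen.1 hc'
    have h4 := YoungDiagram.mem_iff_lt_colLen.1 hc'
    simp only [Set.mem_ofPred_eq] at hμ
    simp only [Finset.mem_product, Finset.mem_range]
    omega
  · intro μ _ ν _ h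
    exact YoungDiagram.ext h

theorem card_eq_of_lrCoeff_ne_zero {μ ν lam : YoungDiagram} (h : lrCoeff μ ν lam ≠ 0) :
    μ.card + ν.card = lam.card := by
  obtain ⟨⟨T⟩, -⟩ := Nat.card_ne_zero.1 h
  have hle : μ.cells ⊆ lam.cells := YoungDiagram.cells_subset_iff.2 T.1.inner_le
  have h1 : (lam.cells \ μ.cells).card = ∑ k ∈ Finset.range (ν.colLen 0), ν.rowLen k := by
    rw [Finset.card_eq_sum_card_fiberwise (f := fun c => T.1.entry c.1 c.2 - 1)
      (t := Finset.range (ν.colLen 0))]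
    · refine Finset.sum_congr rfl fun k _ => ?_
      rw [← T.2.1 k, SkewTableau.content]
      congr 1
      refine Finset.filter_congr fun c hc => ?_
      simp only [Finset.mem_sdiff, YoungDiagram.mem_cells] at hc
      have := T.1.pos c.1 c.2 hc.1 hc.2
      omega
    · intro c hc
      simp only [Finset.coe_sdiff, Set.mem_sdiff, Finset.mem_coe, YoungDiagram.mem_cells] at hc
      have := T.1.pos c.1 c.2 hc.1 hc.2
      have := T.entry_le c.1 c.2
      simp only [Finset.coe_range, Set.mem_Iio]
      omega
  have h2 : ν.cells.card = ∑ k ∈ Finset.range (ν.colLen 0), ν.rowLen k := by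
    rw [Finset.card_eq_sum_card_fiberwise (f := Prod.fst) (t := Finset.range (ν.colLen 0))]
    · exact Finset.sum_congr rfl fun k _ => (YoungDiagram.rowLen_eq_card ν).symm
    · rintro ⟨i, j⟩ hc
      have hc' : (i, j) ∈ ν := hc
      have := YoungDiagram.mem_iff_lt_colLen.1 (ν.up_left_mem le_rfl (Nat.zero_le j) hc')
      simpa using this
  have h3 := Finset.card_sdiff_add_card_eq_card hle
  change μ.cells.card + ν.cells.card = lam.cells.card
  omega

/-- The sum defining the Newell-Littlewood number is finite. -/
theorem nlTerm_support_finite (μ ν lam : YoungDiagram) :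
    (Function.support (nlTerm μ ν lam)).Finite := by
  refine ((finite_card_le μ.card).prod
    ((finite_card_le μ.card).prod (finite_card_le ν.card))).subset ?_
  rintro ⟨α, β, γ⟩ h
  simp only [Function.mem_support, nlTerm, ne_eq, mul_eq_zero, not_or] at h
  have h1 := card_eq_of_lrCoeff_ne_zero h.1.1
  have h2 := card_eq_of_lrCoeff_ne_zero h.1.2
  simp only [Set.mem_prod, Set.mem_ofPred_eq]
  omega

/-! If the summand of $(\alpha,\beta,\gamma)$ is nonzero, then $|\lambda|=|\mu|+|\nu|-2|\alpha|$ and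
$\alpha\subset\mu\cap\nu$, while $|\mu\Delta\nu|=|\mu|+|\nu|-2|\mu\cap\nu|$. This gives the parity
and the bounds in (I), and shows that $|\lambda|>|\mu\Delta\nu|$ means $\alpha\ne\mu\cap\nu$, and
that $|\lambda|<|\mu|+|\nu|$ means $\alpha\ne\emptyset$.

For (II), add a box to $\alpha$ inside $\mu\cap\nu$. Keeping $\mu$ and $\nu$ fixed, $\beta$ and
$\gamma$ can each give up a box with the first two coefficients still positive, and $\lambda$ can
then give up two boxes, one for each. For (III), remove a box from $\alpha$ and let $\beta$,
$\gamma$ and $\lambda$ grow. The rest of (I) follows by descending with (II) from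
$\alpha=\emptyset$, $\lambda=\mu+\nu$.

So everything rests on six one-box moves preserving $c>0$, from `lrCoeff_pos_add_inner` to
`lrCoeff_pos_add_right`: one of the three partitions changes by a prescribed box, a second responds
by some box, the third is fixed. A tableau is replaced by the array $H(i,k)$ counting the boxes of
the first $i$ rows with entry at most $k$, inner boxes included. Semistandardness and the ballot
property become local inequalities on $H$, interchanged by transposition. Each move adds or
subtracts the indicator of a region: an insertion path (row bumping) when boxes are added to the
outer shape, a removal path (a chain of ballot repairs) when the content must shrink.

Throughout, index $k$ stands for the letter $k+1$, and the row end $H(i+1,k)-H(i,k)$ is the column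
where the letters exceeding $k$ begin in row $i$. -/

/-! ### Hives and their symmetry. -/

/-- A rectangular hive encoding a Littlewood-Richardson tableau of shape `P / p` whose reading word
leads from the partition `q` to the partition `Q`. The mixed second difference of `H` at `(i, k)`
is the number of letters `k` in row `i`. -/
structure LRHive (p q P Q : ℕ → ℕ) (H : ℕ → ℕ → ℤ) : Prop where
  left : ∀ i, H (i + 1) 0 = H i 0 + p i
  top : ∀ k, H 0 (k + 1) = H 0 k + q k
  right : ∃ N, ∀ k, N ≤ k → ∀ i, H (i + 1) k = H i k + P i
  bottom : ∃ M, ∀ i, M ≤ i → ∀ k, H i (k + 1) = H i k + Q k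
  count_nonneg : ∀ i k, H (i + 1) k + H i (k + 1) ≤ H (i + 1) (k + 1) + H i k
  column : ∀ i k, H (i + 1 + 1) (k + 1) + H i k ≤ H (i + 1) k + H (i + 1) (k + 1)
  ballot : ∀ i k, H (i + 1) (k + 1 + 1) + H i k ≤ H i (k + 1) + H (i + 1) (k + 1)

/-- The indicator of a proposition, as an integer. -/
noncomputable def ind (a : Prop) : ℤ := open Classical in if a then 1 else 0

theorem ind_true {a : Prop} (h : a) : ind a = 1 := if_pos h

theorem ind_false {a : Prop} (h : ¬ a) : ind a = 0 := if_neg h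

theorem ind_cases (a : Prop) : (a ∧ ind a = 1) ∨ (¬ a ∧ ind a = 0) := by
  by_cases h : a
  · exact Or.inl ⟨h, ind_true h⟩
  · exact Or.inr ⟨h, ind_false h⟩

theorem ind_congr {a b : Prop} (h : a ↔ b) : ind a = ind b := by rw [propext h]

/-- The composition obtained from `f` by adding a box to row `t`. -/
def addBox (f : ℕ → ℕ) (t : ℕ) : ℕ → ℕ := fun i => f i + if i = t then 1 else 0

namespace LRHive

variable {p q P Q : ℕ → ℕ} {H : ℕ → ℕ → ℤ}

/-- The column and ballot inequalities are mirror images. This is the passage to the companion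
tableau, and it lets each move on shapes serve as a move on contents. -/
theorem transpose (h : LRHive p q P Q H) : LRHive q p Q P fun i k => H k i where
  left := h.top
  top := h.left
  right := h.bottom
  bottom := h.right
  count_nonneg i k := by have := h.count_nonneg k i; omega
  column i k := by have := h.ballot k i; omega
  ballot i k := by have := h.column k i; omega

theorem row_le (h : LRHive p q P Q H) (i : ℕ) {k m : ℕ} (hkm : k ≤ m) :
    H (i + 1) k - H i k ≤ H (i + 1) m - H i m := by
  induction m, hkm using Nat.le_induction with
  | base => exact le_rfl
  | succ m _ ih => have := h.count_nonneg i m; omega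

theorem col_le (h : LRHive p q P Q H) (k : ℕ) {i m : ℕ} (him : i ≤ m) :
    H i (k + 1) - H i k ≤ H m (k + 1) - H m k := h.transpose.row_le k him

/-- For large `k` the column inequality compares full row lengths. Hence a composition produced by a
move is automatically a partition. -/
theorem right_antitone (h : LRHive p q P Q H) (i : ℕ) : P (i + 1) ≤ P i := by
  obtain ⟨N, hN⟩ := h.right
  have h1 := h.column i N
  have h2 := hN N le_rfl i
  have h3 := hN (N + 1) (by omega) (i + 1)
  have h4 := hN (N + 1) (by omega) i
  omega

theorem bottom_antitone (h : LRHive p q P Q H) (k : ℕ) : Q (k + 1) ≤ Q k :=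
  h.transpose.right_antitone k

theorem count_eq_zero_of_right {N : ℕ} (hN : ∀ k, N ≤ k → ∀ i, H (i + 1) k = H i k + P i)
    (i k : ℕ) (hk : N ≤ k) : H (i + 1) (k + 1) + H i k = H (i + 1) k + H i (k + 1) := by
  have h1 := hN k hk i
  have h2 := hN (k + 1) (by omega) i
  omega

end LRHive

/-! ### Insertion paths. -/

/-- The recursion defining the region to which an insertion path starting in row `s` adds one:
`L i k` says that `k` is at most the letter to be inserted into row `i`. -/
structure InsertionRegion (H : ℕ → ℕ → ℤ) (s : ℕ) (L : ℕ → ℕ → Prop) : Prop where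
  before : ∀ i, i < s → ∀ k, L (i + 1) k ↔ L i k
  step : ∀ i, s ≤ i → ∀ k, L (i + 1) k ↔
    ∀ m, m < k → H (i + 1) (m + 1) + H i m = H (i + 1) m + H i (m + 1) ∨ L i m
  start : ∀ k, L s (k + 1) → L s k

/-- The insertion region starting from a given initial segment. -/
def insertionRegion (H : ℕ → ℕ → ℤ) (s : ℕ) (L₀ : ℕ → Prop) : ℕ → ℕ → Prop
  | 0, k => L₀ k
  | i + 1, k => (i < s ∧ insertionRegion H s L₀ i k) ∨ (s ≤ i ∧
    ∀ m, m < k → H (i + 1) (m + 1) + H i m = H (i + 1) m + H i (m + 1) ∨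
      insertionRegion H s L₀ i m)

theorem insertionRegion_of_le (H : ℕ → ℕ → ℤ) (s : ℕ) (L₀ : ℕ → Prop) {i : ℕ} (hi : i ≤ s)
    (k : ℕ) : insertionRegion H s L₀ i k ↔ L₀ k := by
  induction i with
  | zero => rfl
  | succ i ih =>
    rw [← ih (by omega), insertionRegion]
    simp [show i < s by omega, show ¬ s ≤ i by omega]

theorem insertionRegion_spec (H : ℕ → ℕ → ℤ) (s : ℕ) (L₀ : ℕ → Prop)
    (h₀ : ∀ k, L₀ (k + 1) → L₀ k) : InsertionRegion H s (insertionRegion H s L₀) where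
  before i hi k := by
    rw [insertionRegion_of_le H s L₀ hi, insertionRegion_of_le H s L₀ hi.le]
  step i hi k := by
    rw [insertionRegion]
    simp [hi, show ¬ i < s by omega]
  start k := by simpa only [insertionRegion_of_le H s L₀ le_rfl] using h₀ k

namespace InsertionRegion

variable {p q P Q : ℕ → ℕ} {H : ℕ → ℕ → ℤ} {s : ℕ} {L : ℕ → ℕ → Prop}

theorem of_le (hL : InsertionRegion H s L) {i : ℕ} (hi : i ≤ s) (k : ℕ) : L i k ↔ L s k := by
  induction hi using Nat.decreasingInduction with
  | self => rfl
  | of_succ i hi ih => exact (hL.before i hi k).symm.trans ih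

theorem down (hL : InsertionRegion H s L) (i k : ℕ) (h : L i (k + 1)) : L i k := by
  rcases le_or_gt i s with hi | hi
  · rw [hL.of_le hi] at h ⊢
    exact hL.start k h
  · obtain ⟨i, rfl⟩ : ∃ j, i = j + 1 := ⟨i - 1, by omega⟩
    rw [hL.step i (by omega)] at h ⊢
    exact fun m hm => h m (by omega)

theorem down_le (hL : InsertionRegion H s L) (i : ℕ) {k m : ℕ} (hkm : k ≤ m) (h : L i m) :
    L i k := by
  induction m, hkm using Nat.le_induction with
  | base => exact h
  | succ m _ ih => exact ih (hL.down i m h)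

theorem mono (hL : InsertionRegion H s L) (i k : ℕ) (h : L i k) : L (i + 1) k := by
  rcases lt_or_ge i s with hi | hi
  · exact (hL.before i hi k).2 h
  · exact (hL.step i hi k).2 fun m hm => Or.inr (hL.down_le i hm.le h)

theorem mono_le (hL : InsertionRegion H s L) (k : ℕ) {i j : ℕ} (hij : i ≤ j) (h : L i k) :
    L j k := by
  induction j, hij using Nat.le_induction with
  | base => exact h
  | succ m _ ih => exact hL.mono m k ih

theorem succ_iff (hL : InsertionRegion H s L) (i k : ℕ) (hi : s ≤ i) :
    L (i + 1) (k + 1) ↔ L (i + 1) k ∧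
      (H (i + 1) (k + 1) + H i k = H (i + 1) k + H i (k + 1) ∨ L i k) := by
  rw [hL.step i hi, hL.step i hi]
  constructor
  · exact fun h => ⟨fun m hm => h m (by omega), h k (by omega)⟩
  · rintro ⟨h1, h2⟩ m hm
    rcases Nat.lt_succ_iff_lt_or_eq.1 hm with hm | rfl
    · exact h1 m hm
    · exact h2

theorem zero (hL : InsertionRegion H s L) (i : ℕ) (hi : s ≤ i) : L (i + 1) 0 :=
  (hL.step i hi 0).2 fun m hm => absurd hm (by omega)

/-- The only count that decreases is that of the bumped letter, where `L (i + 1)` stops; by the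
recursion it stops only at a letter present in row `i`. -/
theorem count_nonneg (hL : InsertionRegion H s L) (h : LRHive p q P Q H) (i k : ℕ) :
    H (i + 1) k + ind (L (i + 1) k) + (H i (k + 1) + ind (L i (k + 1))) ≤
      H (i + 1) (k + 1) + ind (L (i + 1) (k + 1)) + (H i k + ind (L i k)) := by
  have h1 := h.count_nonneg i k
  rcases lt_or_ge i s with hi | hi
  · rw [ind_congr (hL.before i hi k), ind_congr (hL.before i hi (k + 1))]
    omega
  · have h2 := hL.succ_iff i k hi
    have h3 := hL.down i k
    rcases ind_cases (L (i + 1) k) with ⟨_, e1⟩ | ⟨_, e1⟩ <;>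
    rcases ind_cases (L (i + 1) (k + 1)) with ⟨_, e2⟩ | ⟨_, e2⟩ <;>
    rcases ind_cases (L i k) with ⟨_, e3⟩ | ⟨_, e3⟩ <;>
    rcases ind_cases (L i (k + 1)) with ⟨_, e4⟩ | ⟨_, e4⟩ <;>
    simp_all <;> omega

/-- At the letter bumped from row `i`, the end of row `i` jumps, which makes the column inequality
strict. Past it, and up to the letter bumped from row `i + 1`, row `i + 1` contains no letters, so
strictness persists. -/
theorem column_lt (hL : InsertionRegion H s L) (h : LRHive p q P Q H) (i : ℕ) (hi : s ≤ i) :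
    ∀ k, L (i + 1 + 1) (k + 1) → ¬ L (i + 1) k →
      H (i + 1 + 1) (k + 1) + H i k < H (i + 1) k + H (i + 1) (k + 1) := by
  intro k
  induction k with
  | zero => exact fun _ h0 => absurd (hL.zero i hi) h0
  | succ k ih =>
    intro h1 h2
    have h3 := (hL.succ_iff (i + 1) (k + 1) (by omega)).1 h1
    have h4 := hL.succ_iff i k hi
    have h5 := h.column i k
    have h6 := h.count_nonneg i k
    have h8 : H (i + 1 + 1) (k + 1 + 1) + H (i + 1) (k + 1) =
        H (i + 1 + 1) (k + 1) + H (i + 1) (k + 1 + 1) := h3.2.resolve_right h2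
    by_cases h7 : L (i + 1) k
    · have h9 : ¬ (H (i + 1) (k + 1) + H i k = H (i + 1) k + H i (k + 1)) :=
        fun e => h2 (h4.2 ⟨h7, Or.inl e⟩)
      omega
    · have h9 := ih h3.1 h7
      omega

/-- Only an enlarged end of row `i + 1` can do harm, and `column_lt` provides the room. For the
starting row no bump has occurred above, so strictness is supplied by `hs`. -/
theorem column (hL : InsertionRegion H s L) (h : LRHive p q P Q H)
    (hs : ∀ i, i + 1 = s → ∀ k, L (s + 1) (k + 1) → ¬ L s (k + 1) →
      H (i + 1 + 1) (k + 1) + H i k < H (i + 1) k + H (i + 1) (k + 1)) (i k : ℕ) :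
    H (i + 1 + 1) (k + 1) + ind (L (i + 1 + 1) (k + 1)) + (H i k + ind (L i k)) ≤
      H (i + 1) k + ind (L (i + 1) k) + (H (i + 1) (k + 1) + ind (L (i + 1) (k + 1))) := by
  have h1 := h.column i k
  have m1 := hL.mono i k
  have key : L (i + 1 + 1) (k + 1) → ¬ L (i + 1) (k + 1) → (L (i + 1) k ∧ ¬ L i k) ∨
      H (i + 1 + 1) (k + 1) + H i k < H (i + 1) k + H (i + 1) (k + 1) := by
    intro a b
    rcases lt_trichotomy (i + 1) s with hi | rfl | hi
    · exact absurd ((hL.before (i + 1) hi _).1 a) b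
    · exact Or.inr (hs i rfl k a b)
    · by_cases c : L (i + 1) k
      · refine Or.inl ⟨c, fun d => b ?_⟩
        exact (hL.succ_iff i k (by omega)).2 ⟨c, Or.inr d⟩
      · exact Or.inr (hL.column_lt h i (by omega) k a c)
  have m2 := hL.mono (i + 1) (k + 1)
  rcases ind_cases (L (i + 1) k) with ⟨_, e1⟩ | ⟨_, e1⟩ <;>
  rcases ind_cases (L (i + 1) (k + 1)) with ⟨_, e2⟩ | ⟨_, e2⟩ <;>
  rcases ind_cases (L i k) with ⟨_, e3⟩ | ⟨_, e3⟩ <;>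
  rcases ind_cases (L (i + 1 + 1) (k + 1)) with ⟨_, e4⟩ | ⟨_, e4⟩ <;>
  simp_all <;> omega

/-- Danger arises when a letter `k + 1` moves down into row `i`, so that it is counted one row
later. If row `i` does not bump a `k + 2` in turn, it contains none, and the `k + 1` that was
present in the row above makes the old inequality strict. At the starting row `hs` replaces this
argument. -/
theorem ballot (hL : InsertionRegion H s L) (h : LRHive p q P Q H) (i k : ℕ) (hi : s ≤ i)
    (hs : i = s → L s k → ¬ L s (k + 1) → H s (k + 1 + 1) + H s k < H s (k + 1) + H s (k + 1)) :
    H (i + 1) (k + 1 + 1) + ind (L (i + 1) (k + 1 + 1)) + (H i k + ind (L i k)) ≤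
      H i (k + 1) + ind (L i (k + 1)) + (H (i + 1) (k + 1) + ind (L (i + 1) (k + 1))) := by
  have h1 := h.ballot i k
  have h2 := hL.succ_iff i (k + 1) hi
  have key : L i k → ¬ L i (k + 1) → L (i + 1) (k + 1) ∧ (L (i + 1) (k + 1 + 1) →
      H (i + 1) (k + 1 + 1) + H i k < H i (k + 1) + H (i + 1) (k + 1)) := by
    intro a b
    refine ⟨(hL.succ_iff i k hi).2 ⟨hL.mono i k a, Or.inr a⟩, fun c => ?_⟩
    have h3 := (h2.1 c).2.resolve_right b
    rcases eq_or_lt_of_le hi with rfl | hi'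
    · have := hs rfl a b
      omega
    · obtain ⟨j, rfl⟩ : ∃ j, i = j + 1 := ⟨i - 1, by omega⟩
      have h4 := h.ballot j k
      have h5 := h.count_nonneg j k
      have h6 : ¬ (H (j + 1) (k + 1) + H j k = H (j + 1) k + H j (k + 1)) :=
        fun e => b ((hL.succ_iff j k (by omega)).2 ⟨a, Or.inl e⟩)
      omega
  have m1 := hL.down i k
  have m2 := hL.down (i + 1) (k + 1)
  rcases ind_cases (L i k) with ⟨_, e1⟩ | ⟨_, e1⟩ <;>
  rcases ind_cases (L (i + 1) (k + 1)) with ⟨_, e2⟩ | ⟨_, e2⟩ <;>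
  rcases ind_cases (L i (k + 1)) with ⟨_, e3⟩ | ⟨_, e3⟩ <;>
  rcases ind_cases (L (i + 1) (k + 1 + 1)) with ⟨_, e4⟩ | ⟨_, e4⟩ <;>
  simp_all <;> omega

/-- Below the last nonempty row the region contains everything. -/
theorem exists_forall (hL : InsertionRegion H s L) (h : LRHive p q P Q H) :
    ∃ M, ∀ i, M ≤ i → (∀ k, L i k) ∧ ∀ k, H i (k + 1) = H i k + Q k := by
  obtain ⟨M, hM⟩ := h.bottom
  refine ⟨max M s + 1, fun i hi => ⟨fun k => ?_, hM i (by omega)⟩⟩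
  obtain ⟨j, rfl⟩ : ∃ j, i = j + 1 := ⟨i - 1, by omega⟩
  refine (hL.step j (by omega) k).2 fun m _ => Or.inl ?_
  have h1 := hM j (by omega) m
  have h2 := hM (j + 1) (by omega) m
  omega

/-- The insertion path ends with a new box at the end of some row. -/
theorem exists_right (hL : InsertionRegion H s L) (h : LRHive p q P Q H) (r : ℕ)
    (hr : ∀ k, r < k → ¬ L s k) :
    ∃ t N, r < N ∧ ∀ k, N ≤ k → ∀ i, H (i + 1) k + ind (L (i + 1) k) =
      H i k + ind (L i k) + (addBox P t) i := by
  obtain ⟨N₀, hN₀⟩ := h.right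
  obtain ⟨N, hN, hrN⟩ : ∃ N, N₀ ≤ N ∧ r < N := ⟨max N₀ (r + 1), by omega, by omega⟩
  have hstab : ∀ i k, N ≤ k → (L i k ↔ L i N) := by
    intro i k hk
    rcases le_or_gt i s with hi | hi
    · rw [hL.of_le hi, hL.of_le hi]
      exact iff_of_false (hr k (by omega)) (hr N hrN)
    · obtain ⟨i, rfl⟩ : ∃ j, i = j + 1 := ⟨i - 1, by omega⟩
      refine ⟨hL.down_le _ hk, fun hi => ?_⟩
      induction k, hk using Nat.le_induction with
      | base => exact hi
      | succ k hk ih =>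
        exact (hL.succ_iff i k (by omega)).2 ⟨ih,
          Or.inl (LRHive.count_eq_zero_of_right hN₀ i k (by omega))⟩
  obtain ⟨M, hM⟩ := hL.exists_forall h
  classical
  have hex : ∃ i, L i N := ⟨M, (hM M le_rfl).1 N⟩
  have hpos : Nat.find hex ≠ 0 := by
    intro h0
    have h1 := Nat.find_spec hex
    rw [h0, hL.of_le (Nat.zero_le s)] at h1
    exact hr N hrN h1
  -- Past column `N` the region depends on the row only. The row just before the first one it
  -- contains receives a letter and bumps nothing, so it grows.
  refine ⟨Nat.find hex - 1, N, hrN, fun k hk i => ?_⟩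
  have hi : ∀ i, L i k ↔ Nat.find hex ≤ i := by
    intro i
    rw [hstab i k hk]
    exact ⟨fun h1 => Nat.find_min' hex h1, fun h1 => hL.mono_le N h1 (Nat.find_spec hex)⟩
  rw [hN₀ k (by omega) i, ind_congr (hi i), ind_congr (hi (i + 1))]
  simp only [ind, addBox]
  push_cast
  split_ifs <;> omega

end InsertionRegion

/-! ### Moves that add a box to the outer shape. -/

namespace LRHive

variable {p q P Q : ℕ → ℕ} {H : ℕ → ℕ → ℤ}

/-- Adding a box to the inner shape adds a box to the outer shape. -/
theorem add_left (h : LRHive p q P Q H) (s : ℕ)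
    (hp : ∀ i, (addBox p s) (i + 1) ≤ (addBox p s) i) :
    ∃ t H', LRHive (addBox p s) q (addBox P t) Q H' := by
  -- The empty initial region inserts nothing into row `s`: the new inner box just drives out the
  -- smallest letter of that row, if there is one.
  have hL := insertionRegion_spec H s (fun _ => False) (fun _ => id)
  have h0 := fun i hi k => insertionRegion_of_le H s (fun _ => False) (i := i) hi k
  set L := insertionRegion H s fun _ => False
  obtain ⟨t, N, -, hN⟩ := hL.exists_right h 0 fun k _ hk => (h0 s le_rfl k).1 hk
  obtain ⟨M, hM⟩ := hL.exists_forall h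
  refine ⟨t, fun i k => H i k + ind (L i k), ?_, ?_, ⟨N, hN⟩, ⟨M, fun i hi k => ?_⟩,
    hL.count_nonneg h, hL.column h ?_, ?_⟩
  · intro i
    have h1 := h.left i
    simp only [addBox]
    rcases lt_trichotomy i s with hi | rfl | hi
    · rw [ind_false (fun e => (h0 (i + 1) (by omega) 0).1 e),
        ind_false (fun e => (h0 i (by omega) 0).1 e), if_neg (by omega)]
      omega
    · rw [ind_false (fun e => (h0 i le_rfl 0).1 e), ind_true (hL.zero i le_rfl), if_pos rfl]
      push_cast
      omega
    · obtain ⟨j, rfl⟩ : ∃ j, i = j + 1 := ⟨i - 1, by omega⟩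
      rw [ind_true (hL.zero j (by omega)), ind_true (hL.zero (j + 1) (by omega)),
        if_neg (by omega)]
      omega
  · intro k
    have h1 := h.top k
    rw [ind_false (fun e => (h0 0 (by omega) k).1 e),
      ind_false (fun e => (h0 0 (by omega) (k + 1)).1 e)]
    omega
  · have h1 := (hM i hi).2 k
    rw [ind_true ((hM i hi).1 k), ind_true ((hM i hi).1 (k + 1))]
    omega
  · rintro i rfl k h1 -
    have h2 := hp i
    simp only [addBox] at h2
    rw [if_pos trivial, if_neg (by omega)] at h2
    have h3 := h.row_le i (Nat.zero_le k)
    -- The letters up to `k + 1` do not occur in the starting row, so its row end is still the old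
    -- inner length, smaller than that of the row above by `hp`.
    have h4 : ∀ m, m ≤ k + 1 → H (i + 1 + 1) m - H (i + 1) m = p (i + 1) := by
      intro m hm
      induction m with
      | zero => have := h.left (i + 1); omega
      | succ m ih =>
        have h5 := ((hL.step (i + 1) le_rfl _).1 h1 m (by omega)).resolve_right
          (fun e => (h0 _ le_rfl m).1 e)
        have := ih (by omega)
        omega
    have h5 := h4 (k + 1) le_rfl
    have h6 := h.left i
    omega
  · intro i k
    rcases lt_or_ge i s with hi | hi
    · have := h.ballot i k
      rw [ind_false (fun e => (h0 (i + 1) (by omega) _).1 e),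
        ind_false (fun e => (h0 i (by omega) _).1 e), ind_false (fun e => (h0 i (by omega) _).1 e),
        ind_false (fun e => (h0 (i + 1) (by omega) _).1 e)]
      omega
    · exact hL.ballot h i k hi fun _ e => absurd ((h0 s le_rfl _).1 e) id

/-- Removing a box from the partition at which the reading word starts, and keeping the one at
which it ends, adds a box to the outer shape. -/
theorem remove_top (r : ℕ) (h : LRHive p (addBox q r) P Q H)
    (hq : ∀ k, q (k + 1) ≤ q k) :
    ∃ t H', LRHive p q (addBox P t) Q H' := by
  -- The letter `r + 1` lost at the start of the word is inserted into row `0`, which keeps the end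
  -- of the word.
  have hL := insertionRegion_spec H 0 (fun k => k ≤ r) (fun _ => by omega)
  have h0 := fun k => insertionRegion_of_le H 0 (fun k => k ≤ r) le_rfl k
  set L := insertionRegion H 0 fun k => k ≤ r
  obtain ⟨t, N, -, hN⟩ := hL.exists_right h r fun k hk e => absurd ((h0 k).1 e) (by omega)
  obtain ⟨M, hM⟩ := hL.exists_forall h
  refine ⟨t, fun i k => H i k + ind (L i k), ?_, ?_, ⟨N, hN⟩, ⟨M, fun i hi k => ?_⟩,
    hL.count_nonneg h, hL.column h (fun i hi => absurd hi (by omega)), ?_⟩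
  · intro i
    have h1 := h.left i
    have h2 : ∀ i, L i 0 := fun i => hL.mono_le 0 (Nat.zero_le i) ((h0 0).2 (by omega))
    rw [ind_true (h2 i), ind_true (h2 (i + 1))]
    omega
  · intro k
    have h1 := h.top k
    simp only [addBox] at h1
    rw [ind_congr (h0 k), ind_congr (h0 (k + 1))]
    simp only [ind]
    push_cast at h1
    split_ifs at * <;> omega
  · have h1 := (hM i hi).2 k
    rw [ind_true ((hM i hi).1 k), ind_true ((hM i hi).1 (k + 1))]
    omega
  · intro i k
    refine hL.ballot h i k (Nat.zero_le i) fun _ h1 h2 => ?_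
    rw [h0] at h1 h2
    obtain rfl : k = r := by omega
    have h3 := h.top k
    have h4 := h.top (k + 1)
    have h5 := hq k
    simp only [addBox] at h3 h4
    simp only [if_true] at h3
    push_cast at h3 h4
    rw [if_neg (by omega)] at h4
    omega

/-- From row `s` on there is room for one more letter `r + 2` in the ballot condition. Such a row
exists because the inequality is strict at the bottom; minimality gives tightness just above it. -/
theorem exists_addable_row (h : LRHive p q P Q H) (r : ℕ)
    (hQ : Q (r + 1) < Q r) :
    ∃ s, (∀ i, s ≤ i → H (i + 1) (r + 1 + 1) + H i r < H i (r + 1) + H (i + 1) (r + 1)) ∧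
      ∀ i, i + 1 = s → H (i + 1) (r + 1 + 1) + H i r = H i (r + 1) + H (i + 1) (r + 1) := by
  obtain ⟨M, hM⟩ := h.bottom
  classical
  have hex : ∃ s, ∀ i, s ≤ i →
      H (i + 1) (r + 1 + 1) + H i r < H i (r + 1) + H (i + 1) (r + 1) := by
    refine ⟨M, fun i hi => ?_⟩
    have h1 := hM i hi r
    have h2 := hM (i + 1) (by omega) (r + 1)
    omega
  refine ⟨Nat.find hex, Nat.find_spec hex, fun i hi => ?_⟩
  have h1 := Nat.find_min hex (m := i) (by omega)
  by_contra hne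
  refine h1 fun j hj => ?_
  rcases eq_or_lt_of_le hj with rfl | hj
  · exact lt_of_le_of_ne (h.ballot i r) hne
  · exact Nat.find_spec hex j (by omega)

/-- Adding a box to the content adds a box to the outer shape. -/
theorem add_bottom (h : LRHive p q P Q H) (r : ℕ)
    (hQ : ∀ k, (addBox Q r) (k + 1) ≤ (addBox Q r) k) :
    ∃ t H', LRHive p q (addBox P t) (addBox Q r) H' := by
  obtain ⟨s, hs1, hs2, hs3⟩ : ∃ s, (∀ i, s ≤ i → ∀ m, m + 1 = r →
        H (i + 1) (m + 1 + 1) + H i m < H i (m + 1) + H (i + 1) (m + 1)) ∧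
      (∀ i, i + 1 = s → ∀ m, m + 1 = r →
        H (i + 1) (m + 1 + 1) + H i m = H i (m + 1) + H (i + 1) (m + 1)) ∧ (r = 0 → s = 0) := by
    rcases Nat.eq_zero_or_pos r with rfl | hr
    -- An additional letter `1` is unconstrained from above by the ballot condition, so it can enter
    -- row `0`.
    · exact ⟨0, fun _ _ _ _ => by omega, fun _ _ _ _ => by omega, fun _ => rfl⟩
    · obtain ⟨m, rfl⟩ : ∃ m, r = m + 1 := ⟨r - 1, by omega⟩
      have h1 := hQ m
      simp only [addBox] at h1
      rw [if_pos trivial, if_neg (by omega)] at h1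
      obtain ⟨s, h2, h3⟩ := h.exists_addable_row m (by omega)
      refine ⟨s, fun i hi n hn => ?_, fun i hi n hn => ?_, fun h => absurd h (by omega)⟩
      · obtain rfl : n = m := by omega
        exact h2 i hi
      · obtain rfl : n = m := by omega
        exact h3 i hi
  have hL := insertionRegion_spec H s (fun k => k ≤ r) (fun _ => by omega)
  have h0 := fun i hi k => insertionRegion_of_le H s (fun k => k ≤ r) (i := i) hi k
  set L := insertionRegion H s fun k => k ≤ r
  obtain ⟨t, N, hrN, hN⟩ := hL.exists_right h r
    fun k hk e => absurd ((h0 s le_rfl k).1 e) (by omega)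
  obtain ⟨M, hM⟩ := hL.exists_forall h
  -- The correction cancels the region in the rows up to the start, so the new letter `r + 1` first
  -- appears in row `s` and the start of the word is unchanged.
  refine ⟨t, fun i k => H i k + ind (L i k) - ind (k ≤ r), ?_, ?_,
    ⟨N, fun k hk i => ?_⟩, ⟨M, fun i hi k => ?_⟩, fun i k => ?_, fun i k => ?_, fun i k => ?_⟩
  · intro i
    have h1 := h.left i
    have h2 : ∀ i, L i 0 := fun i => hL.mono_le 0 (Nat.zero_le i) ((h0 0 (by omega) 0).2 (by omega))
    rw [ind_true (h2 i), ind_true (h2 (i + 1))]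
    omega
  · intro k
    have h1 := h.top k
    rw [ind_congr (h0 0 (by omega) k), ind_congr (h0 0 (by omega) (k + 1))]
    omega
  · have := hN k hk i
    omega
  · have h1 := (hM i hi).2 k
    rw [ind_true ((hM i hi).1 k), ind_true ((hM i hi).1 (k + 1))]
    simp only [addBox, ind]
    push_cast
    split_ifs at * <;> omega
  · have := hL.count_nonneg h i k
    omega
  · have := hL.column h (fun j hj m h1 h2 => ?_) i k
    · omega
    -- The ballot inequality is tight in row `s - 1` and strict in row `s`. With the column
    -- inequality this makes the end of row `s` at letter `r + 1` strictly less than the end of row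
    -- `s - 1` at letter `r`; row `s` has no relevant larger letters.
    · have hjr : r ≠ 0 := fun e => by have := hs3 e; omega
      obtain ⟨n, rfl⟩ : ∃ n, r = n + 1 := ⟨r - 1, by omega⟩
      have h3 := hs2 j hj n rfl
      have h4 := hs1 s le_rfl n rfl
      subst hj
      have h5 := h.column j n
      rw [h0 _ le_rfl] at h2
      have h6 := h.row_le j (k := n + 1) (m := m) (by omega)
      have h7 : ∀ k, n + 1 + 1 ≤ k → k ≤ m + 1 →
          H (j + 1 + 1) k - H (j + 1) k = H (j + 1 + 1) (n + 1 + 1) - H (j + 1) (n + 1 + 1) := by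
        intro k hk
        induction k, hk using Nat.le_induction with
        | base => exact fun _ => rfl
        | succ k hk ih =>
          intro hkm
          have h8 := ((hL.step (j + 1) le_rfl _).1 h1 k (by omega)).resolve_right
            (fun e => absurd ((h0 _ le_rfl k).1 e) (by omega))
          have := ih (by omega)
          omega
      have h8 := h7 (m + 1) (by omega) le_rfl
      omega
  · rcases lt_or_ge i s with hi | hi
    · have := h.ballot i k
      rw [ind_congr (h0 (i + 1) (by omega) (k + 1 + 1)), ind_congr (h0 i (by omega) k),
        ind_congr (h0 i (by omega) (k + 1)), ind_congr (h0 (i + 1) (by omega) (k + 1))]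
      omega
    · by_cases hk : k + 1 = r
      · have h1 := hs1 i hi k hk
        have h2 : ∀ m, m ≤ r → L i m := fun m hm =>
          hL.mono_le m (Nat.zero_le i) ((h0 0 (by omega) m).2 hm)
        have h3 := hL.mono i _ (h2 (k + 1) (by omega))
        rw [ind_true (h2 k (by omega)), ind_true (h2 (k + 1) (by omega)), ind_true h3,
          ind_true (show k ≤ r by omega), ind_true (show k + 1 ≤ r by omega),
          ind_false (show ¬ k + 1 + 1 ≤ r by omega)]
        rcases ind_cases (L (i + 1) (k + 1 + 1)) with ⟨_, e⟩ | ⟨_, e⟩ <;> omega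
      -- Here the region alone could violate the ballot inequality, as if an `r + 1` had been moved
      -- down from above; the correction term restores it.
      · by_cases hsk : i = s ∧ k = r
        · obtain ⟨rfl, rfl⟩ := hsk
          have h1 := h.ballot i k
          have h2 := hL.down (i + 1) (k + 1)
          have h3 : L i k := (h0 i le_rfl k).2 le_rfl
          have h4 : ¬ L i (k + 1) := fun e => absurd ((h0 i le_rfl (k + 1)).1 e) (by omega)
          rw [ind_true h3, ind_false h4, ind_true (le_refl k),
            ind_false (show ¬ k + 1 ≤ k by omega), ind_false (show ¬ k + 1 + 1 ≤ k by omega)]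
          rcases ind_cases (L (i + 1) (k + 1 + 1)) with ⟨e1, e⟩ | ⟨_, e⟩
          · rw [ind_true (h2 e1), e]; omega
          · rcases ind_cases (L (i + 1) (k + 1)) with ⟨_, e'⟩ | ⟨_, e'⟩ <;> omega
        · have h1 := hL.ballot h i k hi fun e1 e2 e3 => by
            rw [h0 _ le_rfl] at e2 e3
            omega
          have h2 : ind (k + 1 + 1 ≤ r) = ind (k + 1 ≤ r) := ind_congr (by omega)
          have h3 : ind (k + 1 ≤ r) ≤ ind (k ≤ r) := by
            simp only [ind]; split_ifs <;> omega
          omega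

end LRHive

/-! ### Removal paths. -/

/-- The recursion defining the region from which a removal path starting at the letter `x`
subtracts one: `G i k` says that the letter `k` is removed from a row with index at least `i`. -/
structure RemovalRegion (H : ℕ → ℕ → ℤ) (x : ℕ) (G : ℕ → ℕ → Prop) : Prop where
  before : ∀ k, k < x → ∀ i, G i (k + 1) ↔ G i k
  step : ∀ k, x ≤ k → ∀ i, G i (k + 1) ↔
    ∀ j, j < i → H (j + 1) (k + 1 + 1) + H j k = H j (k + 1) + H (j + 1) (k + 1) → G j k
  start : ∀ i, G (i + 1) x → G i x

/-- The removal region starting from a given initial segment. -/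
def removalRegion (H : ℕ → ℕ → ℤ) (x : ℕ) (G₀ : ℕ → Prop) : ℕ → ℕ → Prop
  | i, 0 => G₀ i
  | i, k + 1 => (k < x ∧ removalRegion H x G₀ i k) ∨ (x ≤ k ∧
    ∀ j, j < i → H (j + 1) (k + 1 + 1) + H j k = H j (k + 1) + H (j + 1) (k + 1) →
      removalRegion H x G₀ j k)

theorem removalRegion_of_le (H : ℕ → ℕ → ℤ) (x : ℕ) (G₀ : ℕ → Prop) {k : ℕ} (hk : k ≤ x)
    (i : ℕ) : removalRegion H x G₀ i k ↔ G₀ i := by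
  induction k with
  | zero => rw [removalRegion]
  | succ k ih =>
    rw [← ih (by omega), removalRegion]
    simp [show k < x by omega, show ¬ x ≤ k by omega]

theorem removalRegion_spec (H : ℕ → ℕ → ℤ) (x : ℕ) (G₀ : ℕ → Prop)
    (h₀ : ∀ i, G₀ (i + 1) → G₀ i) : RemovalRegion H x (removalRegion H x G₀) where
  before k hk i := by
    rw [removalRegion_of_le H x G₀ hk, removalRegion_of_le H x G₀ hk.le]
  step k hk i := by
    rw [removalRegion]
    simp [hk, show ¬ k < x by omega]
  start i := by simpa only [removalRegion_of_le H x G₀ le_rfl] using h₀ i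

namespace RemovalRegion

variable {p q P Q : ℕ → ℕ} {H : ℕ → ℕ → ℤ} {x : ℕ} {G : ℕ → ℕ → Prop}

theorem of_le (hG : RemovalRegion H x G) {k : ℕ} (hk : k ≤ x) (i : ℕ) : G i k ↔ G i x := by
  induction hk using Nat.decreasingInduction with
  | self => rfl
  | of_succ k hk ih => exact (hG.before k hk i).symm.trans ih

theorem down (hG : RemovalRegion H x G) (i k : ℕ) (h : G (i + 1) k) : G i k := by
  rcases le_or_gt k x with hk | hk
  · rw [hG.of_le hk] at h ⊢
    exact hG.start i h
  · obtain ⟨k, rfl⟩ : ∃ j, k = j + 1 := ⟨k - 1, by omega⟩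
    rw [hG.step k (by omega)] at h ⊢
    exact fun m hm => h m (by omega)

theorem down_le (hG : RemovalRegion H x G) (k : ℕ) {i j : ℕ} (hij : i ≤ j) (h : G j k) :
    G i k := by
  induction j, hij using Nat.le_induction with
  | base => exact h
  | succ m _ ih => exact ih (hG.down m k h)

theorem mono (hG : RemovalRegion H x G) (i k : ℕ) (h : G i k) : G i (k + 1) := by
  rcases lt_or_ge k x with hk | hk
  · exact (hG.before k hk i).2 h
  · exact (hG.step k hk i).2 fun j hj _ => hG.down_le k hj.le h

theorem mono_le (hG : RemovalRegion H x G) (i : ℕ) {k m : ℕ} (hkm : k ≤ m) (h : G i k) :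
    G i m := by
  induction m, hkm using Nat.le_induction with
  | base => exact h
  | succ m _ ih => exact hG.mono i m ih

theorem succ_iff (hG : RemovalRegion H x G) (i k : ℕ) (hk : x ≤ k) :
    G (i + 1) (k + 1) ↔ G i (k + 1) ∧
      (H (i + 1) (k + 1 + 1) + H i k = H i (k + 1) + H (i + 1) (k + 1) → G i k) := by
  rw [hG.step k hk, hG.step k hk]
  constructor
  · exact fun h => ⟨fun m hm => h m (by omega), h i (by omega)⟩
  · rintro ⟨h1, h2⟩ m hm
    rcases Nat.lt_succ_iff_lt_or_eq.1 hm with hm | rfl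
    · exact h1 m hm
    · exact h2

theorem zero (hG : RemovalRegion H x G) (k : ℕ) (hk : x ≤ k) : G 0 (k + 1) :=
  (hG.step k hk 0).2 fun m hm => absurd hm (by omega)

/-- The letters to be removed are there. -/
theorem count_pos (hG : RemovalRegion H x G) (h : LRHive p q P Q H)
    (h0 : ∀ i, G i x → ¬ G (i + 1) x → H (i + 1) x + H i (x + 1) < H (i + 1) (x + 1) + H i x)
    (h1 : ¬ G 0 x → H 0 (x + 1 + 1) + H 0 x < H 0 (x + 1) + H 0 (x + 1)) {k : ℕ} (hk : x ≤ k) :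
    ∀ i, G i k → ¬ G (i + 1) k → H (i + 1) k + H i (k + 1) < H (i + 1) (k + 1) + H i k := by
  induction k, hk using Nat.le_induction with
  | base => exact h0
  | succ k hk ih =>
    intro i a b
    have h2 : H (i + 1) (k + 1 + 1) + H i k = H i (k + 1) + H (i + 1) (k + 1) ∧ ¬ G i k := by
      by_contra hc
      exact b ((hG.succ_iff i k hk).2 ⟨a, by tauto⟩)
    rcases Nat.eq_zero_or_pos i with rfl | hi
    · have h3 : k = x := by
        by_contra hne
        obtain ⟨m, rfl⟩ : ∃ m, k = m + 1 := ⟨k - 1, by omega⟩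
        exact h2.2 (hG.zero m (by omega))
      subst h3
      have := h1 h2.2
      omega
    -- Tightness in row `j + 1` against the inequality in row `j` bounds the number of `k + 2` in
    -- row `j + 1` below by the number of `k + 1` in row `j` plus the slack in row `j`. One of the
    -- two is positive.
    · obtain ⟨j, rfl⟩ : ∃ j, i = j + 1 := ⟨i - 1, by omega⟩
      have h3 := h.ballot j k
      have h4 := h.count_nonneg j k
      by_cases h5 : G j k
      · have h6 := ih j h5 h2.2
        omega
      · have h6 := mt ((hG.succ_iff j k hk).1 a).2 h5
        omega

theorem count_nonneg (hG : RemovalRegion H x G) (h : LRHive p q P Q H)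
    (h0 : ∀ i, G i x → ¬ G (i + 1) x → H (i + 1) x + H i (x + 1) < H (i + 1) (x + 1) + H i x)
    (h1 : ¬ G 0 x → H 0 (x + 1 + 1) + H 0 x < H 0 (x + 1) + H 0 (x + 1)) (i k : ℕ) :
    H (i + 1) k - ind (G (i + 1) k) + (H i (k + 1) - ind (G i (k + 1))) ≤
      H (i + 1) (k + 1) - ind (G (i + 1) (k + 1)) + (H i k - ind (G i k)) := by
  have h2 := h.count_nonneg i k
  rcases lt_or_ge k x with hk | hk
  · rw [ind_congr (hG.before k hk i), ind_congr (hG.before k hk (i + 1))]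
    omega
  · have h3 := hG.count_pos h h0 h1 hk i
    have h4 := hG.down i (k + 1)
    rcases ind_cases (G (i + 1) k) with ⟨_, e1⟩ | ⟨_, e1⟩ <;>
    rcases ind_cases (G (i + 1) (k + 1)) with ⟨_, e2⟩ | ⟨_, e2⟩ <;>
    rcases ind_cases (G i k) with ⟨_, e3⟩ | ⟨_, e3⟩ <;>
    rcases ind_cases (G i (k + 1)) with ⟨_, e4⟩ | ⟨_, e4⟩ <;>
    simp_all <;> omega

/-- When a `k + 2` in row `i + 1` becomes a `k + 1`, the ballot inequality is tight there. Unless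
the end of row `i` at `k` moves too, it is slack in row `i`, and the column inequality at `k + 1`
turns this slack into the needed room. -/
theorem column (hG : RemovalRegion H x G) (h : LRHive p q P Q H)
    (i k : ℕ) (hk : x ≤ k) :
    H (i + 1 + 1) (k + 1) - ind (G (i + 1 + 1) (k + 1)) + (H i k - ind (G i k)) ≤
      H (i + 1) k - ind (G (i + 1) k) + (H (i + 1) (k + 1) - ind (G (i + 1) (k + 1))) := by
  have h1 := h.column i k
  have h2 := h.column i (k + 1)
  have h3 := h.ballot i k
  have key : G (i + 1) (k + 1) → ¬ G (i + 1 + 1) (k + 1) → ¬ G (i + 1) k ∧ (G i k ∨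
      H (i + 1 + 1) (k + 1) + H i k < H (i + 1) k + H (i + 1) (k + 1)) := by
    intro a b
    have h4 : H (i + 1 + 1) (k + 1 + 1) + H (i + 1) k = H (i + 1) (k + 1) + H (i + 1 + 1) (k + 1) ∧
        ¬ G (i + 1) k := by
      by_contra hc
      exact b ((hG.succ_iff (i + 1) k hk).2 ⟨a, by tauto⟩)
    refine ⟨h4.2, or_iff_not_imp_left.2 fun c => ?_⟩
    have h5 := mt ((hG.succ_iff i k hk).1 a).2 c
    omega
  have m1 := hG.down i k
  have m2 := hG.down (i + 1) (k + 1)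
  rcases ind_cases (G (i + 1) k) with ⟨_, e1⟩ | ⟨_, e1⟩ <;>
  rcases ind_cases (G (i + 1) (k + 1)) with ⟨_, e2⟩ | ⟨_, e2⟩ <;>
  rcases ind_cases (G i k) with ⟨_, e3⟩ | ⟨_, e3⟩ <;>
  rcases ind_cases (G (i + 1 + 1) (k + 1)) with ⟨_, e4⟩ | ⟨_, e4⟩ <;>
  simp_all <;> omega

/-- The loss of a `k + 1` is harmless until the first tight row below it. There the recursion turns
a `k + 2` into a `k + 1`, so that both counts are corrected and the deficit passes to `k + 2`. -/
theorem ballot (hG : RemovalRegion H x G) (h : LRHive p q P Q H) (i k : ℕ) :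
    H (i + 1) (k + 1 + 1) - ind (G (i + 1) (k + 1 + 1)) + (H i k - ind (G i k)) ≤
      H i (k + 1) - ind (G i (k + 1)) + (H (i + 1) (k + 1) - ind (G (i + 1) (k + 1))) := by
  have h1 := h.ballot i k
  have m1 := hG.mono i k
  have m2 := hG.mono (i + 1) (k + 1)
  rcases lt_or_ge k x with hk | hk
  · rw [ind_congr (hG.before k hk i)]
    rcases ind_cases (G (i + 1) (k + 1)) with ⟨_, e2⟩ | ⟨_, e2⟩ <;>
    rcases ind_cases (G (i + 1) (k + 1 + 1)) with ⟨_, e4⟩ | ⟨_, e4⟩ <;>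
    simp_all <;> omega
  · have key : ¬ G i k → G i (k + 1) → G (i + 1) (k + 1 + 1) ∧ (G (i + 1) (k + 1) →
        H (i + 1) (k + 1 + 1) + H i k < H i (k + 1) + H (i + 1) (k + 1)) := by
      intro a b
      refine ⟨(hG.succ_iff i (k + 1) (by omega)).2 ⟨hG.mono i _ b, fun _ => b⟩, fun c => ?_⟩
      have := mt ((hG.succ_iff i k hk).1 c).2 a
      omega
    rcases ind_cases (G i k) with ⟨_, e1⟩ | ⟨_, e1⟩ <;>
    rcases ind_cases (G (i + 1) (k + 1)) with ⟨_, e2⟩ | ⟨_, e2⟩ <;>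
    rcases ind_cases (G i (k + 1)) with ⟨_, e3⟩ | ⟨_, e3⟩ <;>
    rcases ind_cases (G (i + 1) (k + 1 + 1)) with ⟨_, e4⟩ | ⟨_, e4⟩ <;>
    simp_all <;> omega

/-- Beyond the largest letter the region contains everything. -/
theorem exists_forall (hG : RemovalRegion H x G) (h : LRHive p q P Q H)
    (h0 : ∀ i, G i x → ¬ G (i + 1) x → H (i + 1) x + H i (x + 1) < H (i + 1) (x + 1) + H i x)
    (h1 : ¬ G 0 x → H 0 (x + 1 + 1) + H 0 x < H 0 (x + 1) + H 0 (x + 1)) :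
    ∃ N, x < N ∧ ∀ k, N ≤ k → (∀ i, G i k) ∧ ∀ i, H (i + 1) k = H i k + P i := by
  obtain ⟨N, hN⟩ := h.right
  refine ⟨max N x + 1, by omega, fun k hk => ⟨fun i => ?_, hN k (by omega)⟩⟩
  induction i with
  | zero =>
    obtain ⟨m, rfl⟩ : ∃ m, k = m + 1 := ⟨k - 1, by omega⟩
    exact hG.zero m (by omega)
  | succ i ih =>
    by_contra hc
    have h2 := hG.count_pos h h0 h1 (by omega) i ih hc
    have h3 := LRHive.count_eq_zero_of_right hN i k (by omega)
    omega

/-- The removal path ends by removing one letter from the content. -/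
theorem exists_bottom (hG : RemovalRegion H x G) (h : LRHive p q P Q H)
    (h0 : ∀ i, G i x → ¬ G (i + 1) x → H (i + 1) x + H i (x + 1) < H (i + 1) (x + 1) + H i x)
    (h1 : ¬ G 0 x → H 0 (x + 1 + 1) + H 0 x < H 0 (x + 1) + H 0 (x + 1))
    (hx : ∃ i, ¬ G i x) :
    ∃ t Q' M, Q = addBox Q' t ∧ ∀ i, M ≤ i → ∀ k,
      H i (k + 1) - ind (G i (k + 1)) = H i k - ind (G i k) + Q' k := by
  obtain ⟨M₀, hM₀⟩ := h.bottom
  obtain ⟨i₀, hi₀⟩ := hx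
  obtain ⟨M, hM, hiM⟩ : ∃ M, M₀ ≤ M ∧ i₀ ≤ M := ⟨max M₀ i₀, by omega, by omega⟩
  obtain ⟨N, hxN, hN⟩ := hG.exists_forall h h0 h1
  have hMx : ∀ i, M ≤ i → ¬ G i x := fun i hi e => hi₀ (hG.down_le x (by omega) e)
  have hstab : ∀ i, M ≤ i → ∀ k, G i k ↔ G M k := by
    intro i hi k
    rcases le_or_gt k x with hk | hk
    · rw [hG.of_le hk, hG.of_le hk]
      exact iff_of_false (hMx i hi) (hMx M le_rfl)
    · refine ⟨hG.down_le k hi, fun e => ?_⟩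
      induction i, hi using Nat.le_induction with
      | base => exact e
      | succ i hi ih =>
        by_contra hc
        have h2 := hG.count_pos h h0 h1 hk.le i ih hc
        have h3 := hM₀ i (by omega) k
        have h4 := hM₀ (i + 1) (by omega) k
        omega
  classical
  have hex : ∃ k, G M k := ⟨N, (hN N le_rfl).1 M⟩
  have hlt : x < Nat.find hex := by
    by_contra hc
    exact hMx M le_rfl ((hG.of_le (by omega) M).1 (Nat.find_spec hex))
  obtain ⟨t, ht⟩ : ∃ t, Nat.find hex = t + 1 := ⟨Nat.find hex - 1, by omega⟩
  have htG : ¬ G M t := Nat.find_min hex (by omega)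
  -- `Q'` is defined by truncated subtraction, so a letter `t + 1` must be shown to exist: either
  -- the path removes one from some row, or it starts with one in the initial partition.
  have hpos : 0 < Q t := by
    have hq : ∀ i, H i t ≤ H i (t + 1) := fun i => by
      have h2 := h.col_le t (Nat.zero_le i)
      have h3 := h.top t
      omega
    have hQ : ∃ i, H i t < H i (t + 1) := by
      by_cases hG0 : G 0 t
      · have hex' : ∃ i, ¬ G i t := ⟨M, htG⟩
        obtain ⟨j, hj⟩ : ∃ j, Nat.find hex' = j + 1 := by
          refine ⟨Nat.find hex' - 1, ?_⟩
          have : Nat.find hex' ≠ 0 := fun e => by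
            have := Nat.find_spec hex'
            rw [e] at this
            exact this hG0
          omega
        have h2 : G j t := by
          by_contra hc
          have := Nat.find_min' hex' hc
          omega
        have h3 : ¬ G (j + 1) t := hj ▸ Nat.find_spec hex'
        have h4 := hG.count_pos h h0 h1 (by omega) j h2 h3
        have h5 := hq j
        exact ⟨j + 1, by omega⟩
      · obtain rfl : t = x := by
          by_contra hne
          obtain ⟨m, rfl⟩ : ∃ m, t = m + 1 := ⟨t - 1, by omega⟩
          exact hG0 (hG.zero m (by omega))
        have h2 := h1 hG0
        have h3 := h.top (t + 1)
        exact ⟨0, by omega⟩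
    obtain ⟨i, hi⟩ := hQ
    have h2 := h.col_le t (le_max_left i M)
    have h3 := hM₀ (max i M) (by omega) t
    omega
  refine ⟨t, fun k => Q k - if k = t then 1 else 0, M, funext fun k => ?_, fun i hi k => ?_⟩
  · simp only [addBox]
    split_ifs with hk
    · subst hk; omega
    · omega
  · have hk : ∀ k, G i k ↔ t + 1 ≤ k := by
      intro k
      rw [hstab i hi, ← ht]
      exact ⟨fun e => Nat.find_min' hex e, fun e => hG.mono_le M e (Nat.find_spec hex)⟩
    have h2 := hM₀ i (by omega) k
    rw [ind_congr (hk k), ind_congr (hk (k + 1))]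
    simp only [ind]
    by_cases hkt : k = t
    · subst hkt
      rw [if_pos (by omega), if_neg (by omega), if_pos rfl]
      omega
    · rw [if_neg hkt]
      split_ifs <;> omega

end RemovalRegion

/-! ### Moves that remove a box from the content. -/

namespace LRHive

variable {p q P Q : ℕ → ℕ} {H : ℕ → ℕ → ℤ}

/-- Removing a box from the partition at which the reading word starts, and keeping the shape,
removes a box from the partition at which it ends. -/
theorem remove_top_bottom (r : ℕ) (h : LRHive p (addBox q r) P Q H)
    (hq : ∀ k, q (k + 1) ≤ q k) :
    ∃ t Q' H', Q = addBox Q' t ∧ LRHive p q P Q' H' := by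
  -- The letter `r + 1` is lost before row `0` is read, so the region at the starting letter is
  -- empty.
  have hG := removalRegion_spec H r (fun _ => False) (fun _ => id)
  have h0 := fun k hk i => removalRegion_of_le H r (fun _ => False) (k := k) hk i
  set G := removalRegion H r fun _ => False
  have hs : ∀ i, G i r → ¬ G (i + 1) r →
      H (i + 1) r + H i (r + 1) < H (i + 1) (r + 1) + H i r :=
    fun i e => absurd ((h0 r le_rfl i).1 e) id
  have ht : ¬ G 0 r → H 0 (r + 1 + 1) + H 0 r < H 0 (r + 1) + H 0 (r + 1) := by
    intro _
    have h3 := h.top r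
    have h4 := h.top (r + 1)
    have h5 := hq r
    simp only [addBox] at h3 h4
    simp only [if_true] at h3
    push_cast at h3 h4
    rw [if_neg (by omega)] at h4
    omega
  obtain ⟨t, Q', M, rfl, hM⟩ := hG.exists_bottom h hs ht ⟨0, fun e => (h0 r le_rfl 0).1 e⟩
  obtain ⟨N, -, hN⟩ := hG.exists_forall h hs ht
  refine ⟨t, Q', fun i k => H i k - ind (G i k), rfl, fun i => ?_, fun k => ?_,
    ⟨N, fun k hk i => ?_⟩, ⟨M, hM⟩, hG.count_nonneg h hs ht, fun i k => ?_, hG.ballot h⟩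
  · have h1 := h.left i
    rw [ind_false (fun e => (h0 0 (by omega) i).1 e),
      ind_false (fun e => (h0 0 (by omega) (i + 1)).1 e)]
    omega
  · have h1 := h.top k
    have h2 : ∀ k, G 0 k ↔ r < k := by
      refine fun k => ⟨fun e => ?_, fun e => ?_⟩
      · by_contra hc
        exact (h0 k (by omega) 0).1 e
      · obtain ⟨m, rfl⟩ : ∃ m, k = m + 1 := ⟨k - 1, by omega⟩
        exact hG.zero m (by omega)
    rw [ind_congr (h2 k), ind_congr (h2 (k + 1))]
    simp only [addBox, ind] at h1 ⊢
    push_cast at h1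
    split_ifs at * <;> omega
  · have h1 := (hN k hk).2 i
    rw [ind_true ((hN k hk).1 i), ind_true ((hN k hk).1 (i + 1))]
    omega
  · rcases lt_or_ge k r with hk | hk
    · have h1 := h.column i k
      rw [ind_false (fun e => (h0 k hk.le _).1 e), ind_false (fun e => (h0 k hk.le _).1 e),
        ind_false (fun e => (h0 (k + 1) hk _).1 e), ind_false (fun e => (h0 (k + 1) hk _).1 e)]
      omega
    · exact hG.column h i k hk

/-- Adding a box to the inner shape removes a box from the content. -/
theorem add_left_bottom (h : LRHive p q P Q H) (s : ℕ)
    (hp : ∀ i, addBox p s (i + 1) ≤ addBox p s i) (hs : p s < P s) :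
    ∃ t Q' H', Q = addBox Q' t ∧ LRHive (addBox p s) q P Q' H' := by
  -- The letter `x + 1` is the smallest in row `s`; its leftmost box is absorbed into the inner
  -- shape.
  obtain ⟨x, hx, hx'⟩ : ∃ x, H (s + 1) x + H s (x + 1) < H (s + 1) (x + 1) + H s x ∧
      ∀ k, k ≤ x → H (s + 1) k - H s k = p s := by
    classical
    have hex : ∃ x, H (s + 1) x - H s x ≠ p s := by
      obtain ⟨N, hN⟩ := h.right
      have := hN N le_rfl s
      exact ⟨N, by omega⟩
    have h1 := Nat.find_spec hex
    have h2 : Nat.find hex ≠ 0 := fun e => by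
      rw [e] at h1
      have := h.left s
      omega
    obtain ⟨x, hx⟩ : ∃ x, Nat.find hex = x + 1 := ⟨Nat.find hex - 1, by omega⟩
    have h3 : ∀ k, k ≤ x → H (s + 1) k - H s k = p s := fun k hk => by
      have := Nat.find_min hex (m := k) (by omega)
      omega
    refine ⟨x, ?_, h3⟩
    rw [hx] at h1
    have h4 := h.count_nonneg s x
    have h5 := h3 x le_rfl
    omega
  have hG := removalRegion_spec H x (fun i => i ≤ s) (fun _ => by omega)
  have h0 := fun k hk i => removalRegion_of_le H x (fun i => i ≤ s) (k := k) hk i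
  set G := removalRegion H x fun i => i ≤ s
  have hstart : ∀ i, G i x → ¬ G (i + 1) x →
      H (i + 1) x + H i (x + 1) < H (i + 1) (x + 1) + H i x := by
    intro i a b
    rw [h0 x le_rfl] at a b
    obtain rfl : i = s := by omega
    exact hx
  have htop : ¬ G 0 x → H 0 (x + 1 + 1) + H 0 x < H 0 (x + 1) + H 0 (x + 1) :=
    fun e => absurd ((h0 x le_rfl 0).2 (by omega)) e
  obtain ⟨t, Q', M, rfl, hM⟩ := hG.exists_bottom h hstart htop
    ⟨s + 1, fun e => absurd ((h0 x le_rfl _).1 e) (by omega)⟩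
  obtain ⟨N, -, hN⟩ := hG.exists_forall h hstart htop
  refine ⟨t, Q', fun i k => H i k - ind (G i k), rfl, fun i => ?_, fun k => ?_,
    ⟨N, fun k hk i => ?_⟩, ⟨M, hM⟩, hG.count_nonneg h hstart htop, fun i k => ?_, hG.ballot h⟩
  · have h1 := h.left i
    rw [ind_congr (h0 0 (by omega) i), ind_congr (h0 0 (by omega) (i + 1))]
    simp only [addBox, ind]
    push_cast
    split_ifs <;> omega
  · have h1 := h.top k
    have h2 : ∀ k, G 0 k := fun k =>
      hG.mono_le 0 (Nat.zero_le k) ((h0 0 (by omega) 0).2 (by omega))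
    rw [ind_true (h2 k), ind_true (h2 (k + 1))]
    omega
  · have h1 := (hN k hk).2 i
    rw [ind_true ((hN k hk).1 i), ind_true ((hN k hk).1 (i + 1))]
    omega
  · rcases lt_or_ge k x with hk | hk
    · have h1 := h.column i k
      rw [ind_congr (h0 k hk.le i), ind_congr (h0 k hk.le (i + 1)),
        ind_congr (h0 (k + 1) hk (i + 1)), ind_congr (h0 (k + 1) hk (i + 1 + 1))]
      -- Below the starting letter only the inner boundary moves, and `hp` gives room under the row
      -- above `s`.
      by_cases his : i + 1 = s
      · subst his
        have h2 := hx' (k + 1) hk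
        have h3 := hp i
        have h4 := h.row_le i (Nat.zero_le k)
        have h5 := h.left i
        simp only [addBox] at h3
        simp only [if_true] at h3
        rw [if_neg (by omega)] at h3
        rw [ind_true (show i ≤ i + 1 by omega), ind_true (le_refl (i + 1)),
          ind_false (show ¬ i + 1 + 1 ≤ i + 1 by omega)]
        omega
      · simp only [ind]
        split_ifs <;> omega
    · exact hG.column h i k hk

/-- Removing a box from the outer shape removes a box from the content. -/
theorem remove_right_bottom (s : ℕ) (h : LRHive p q (addBox P s) Q H)
    (hP : ∀ i, P (i + 1) ≤ P i) (hs : p s ≤ P s) :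
    ∃ t Q' H', Q = addBox Q' t ∧ LRHive p q P Q' H' := by
  -- The letter `x + 1` is the largest in row `s`; it sits in the box being removed.
  obtain ⟨x, hx, hx'⟩ : ∃ x, H (s + 1) x + H s (x + 1) < H (s + 1) (x + 1) + H s x ∧
      ∀ k, x < k → H (s + 1) k - H s k = P s + 1 := by
    obtain ⟨N, hN⟩ := h.right
    have hN' : ∀ k, N ≤ k → H (s + 1) k - H s k = P s + 1 := fun k hk => by
      have := hN k hk s
      simp only [addBox] at this
      simp only [if_true] at this
      push_cast at this
      omega
    classical
    have hex : ∃ x, H (s + 1) x - H s x = P s + 1 := ⟨N, hN' N le_rfl⟩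
    have h1 := Nat.find_spec hex
    have h2 : Nat.find hex ≠ 0 := fun e => by
      rw [e] at h1
      have := h.left s
      omega
    obtain ⟨x, hx⟩ : ∃ x, Nat.find hex = x + 1 := ⟨Nat.find hex - 1, by omega⟩
    rw [hx] at h1
    have h3 := Nat.find_min hex (m := x) (by omega)
    have h4 := h.count_nonneg s x
    refine ⟨x, by omega, fun k hk => ?_⟩
    have h5 := h.row_le s (k := x + 1) (m := k) hk
    have h6 := h.row_le s (le_max_left k N)
    have h7 := hN' (max k N) (le_max_right k N)
    omega
  have hG := removalRegion_spec H x (fun i => i ≤ s) (fun _ => by omega)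
  have h0 := fun k hk i => removalRegion_of_le H x (fun i => i ≤ s) (k := k) hk i
  set G := removalRegion H x fun i => i ≤ s
  have hstart : ∀ i, G i x → ¬ G (i + 1) x →
      H (i + 1) x + H i (x + 1) < H (i + 1) (x + 1) + H i x := by
    intro i a b
    rw [h0 x le_rfl] at a b
    obtain rfl : i = s := by omega
    exact hx
  have htop : ¬ G 0 x → H 0 (x + 1 + 1) + H 0 x < H 0 (x + 1) + H 0 (x + 1) :=
    fun e => absurd ((h0 x le_rfl 0).2 (by omega)) e
  obtain ⟨t, Q', M, rfl, hM⟩ := hG.exists_bottom h hstart htop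
    ⟨s + 1, fun e => absurd ((h0 x le_rfl _).1 e) (by omega)⟩
  obtain ⟨N, -, hN⟩ := hG.exists_forall h hstart htop
  have hGs : ∀ i k, i ≤ s → G i k := fun i k hi =>
    hG.mono_le i (Nat.zero_le k) ((h0 0 (Nat.zero_le x) i).2 hi)
  have hGs' : ∀ k, x < k → G (s + 1) k := by
    intro k hk
    obtain ⟨m, rfl⟩ : ∃ m, k = m + 1 := ⟨k - 1, by omega⟩
    exact (hG.succ_iff s m (by omega)).2 ⟨hGs _ _ le_rfl, fun _ => hGs _ _ le_rfl⟩
  -- The correction cancels the region for `k ≤ x`. This leaves the inner shape alone, and the box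
  -- disappears from the right end of row `s`.
  refine ⟨t, Q', fun i k => H i k - ind (G i k) + ind (i ≤ s), rfl, fun i => ?_, fun k => ?_,
    ⟨N, fun k hk i => ?_⟩, ⟨M, fun i hi k => ?_⟩, fun i k => ?_, fun i k => ?_, fun i k => ?_⟩
  · have h1 := h.left i
    rw [ind_congr (h0 0 (by omega) i), ind_congr (h0 0 (by omega) (i + 1))]
    omega
  · have h1 := h.top k
    rw [ind_true (hGs 0 k (by omega)), ind_true (hGs 0 (k + 1) (by omega))]
    omega
  · have h1 := (hN k hk).2 i
    rw [ind_true ((hN k hk).1 i), ind_true ((hN k hk).1 (i + 1))]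
    simp only [addBox, ind] at h1 ⊢
    push_cast at h1
    split_ifs at * <;> omega
  · have := hM i hi k
    omega
  · have := hG.count_nonneg h hstart htop i k
    omega
  · have hc := h.column i k
    have hj : i ≠ s → ind (i + 1 + 1 ≤ s) + ind (i ≤ s) ≤
        ind (i + 1 ≤ s) + ind (i + 1 ≤ s) + ind (i + 1 = s) := by
      intro _
      simp only [ind]
      split_ifs <;> omega
    rcases lt_or_ge k x with hk | hk
    · rw [ind_congr (h0 k hk.le i), ind_congr (h0 k hk.le (i + 1)),
        ind_congr (h0 (k + 1) hk (i + 1)), ind_congr (h0 (k + 1) hk (i + 1 + 1))]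
      omega
    · have h1 := hG.column h i k hk
      by_cases his : i = s
      · subst his
        -- The row below has length at most `P (i + 1) ≤ P i`, so it still fits under the shortened
        -- row.
        have h3 : H (i + 1 + 1) (k + 1 + 1) - H (i + 1) (k + 1 + 1) ≤ P (i + 1) := by
          have h4 := h.row_le (i + 1) (le_max_left (k + 1 + 1) N)
          have h5 := (hN (max (k + 1 + 1) N) (le_max_right _ _)).2 (i + 1)
          simp only [addBox] at h5
          rw [if_neg (by omega)] at h5
          omega
        have h4 := hP i
        have h5 := h.ballot i k
        have h6 := hx' (k + 1) (by omega)
        have h7 := h.count_nonneg (i + 1) (k + 1)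
        rw [ind_true (hGs i k le_rfl), ind_true (hGs' (k + 1) (by omega)), ind_true (le_refl i),
          ind_false (show ¬ i + 1 ≤ i by omega), ind_false (show ¬ i + 1 + 1 ≤ i by omega)]
        by_cases hkx : k = x
        · subst hkx
          have h8 : ¬ G (i + 1) k := fun e => absurd ((h0 k le_rfl _).1 e) (by omega)
          rw [ind_false h8]
          by_cases h9 : G (i + 1 + 1) (k + 1)
          · rw [ind_true h9]
            omega
          · have h10 : H (i + 1 + 1) (k + 1 + 1) + H (i + 1) k =
                H (i + 1) (k + 1) + H (i + 1 + 1) (k + 1) := by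
              by_contra hc
              exact h9 ((hG.succ_iff (i + 1) k le_rfl).2
                ⟨hGs' _ (by omega), fun e => absurd e hc⟩)
            rw [ind_false h9]
            omega
        · have h8 := hGs' k (by omega)
          have h9 : G (i + 1 + 1) (k + 1) :=
            (hG.succ_iff (i + 1) k hk).2 ⟨hGs' _ (by omega), fun _ => h8⟩
          have h10 := hx' k (by omega)
          rw [ind_true h8, ind_true h9]
          omega
      · by_cases his' : i + 1 = s
        · subst his'
          rw [ind_true (hGs i k (by omega)), ind_true (hGs (i + 1) k le_rfl),
            ind_true (hGs (i + 1) (k + 1) le_rfl), ind_true (hGs' (k + 1) (by omega)),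
            ind_true (show i ≤ i + 1 by omega), ind_true (le_refl (i + 1)),
            ind_false (show ¬ i + 1 + 1 ≤ i + 1 by omega)]
          omega
        · have := hj his
          rw [ind_false his'] at this
          omega
  · have := hG.ballot h i k
    omega

end LRHive

/-! ### Skew tableaux through row ends and row counts. -/

theorem count_reverse_range' (f : ℕ → ℕ) (v c n : ℕ) :
    ((List.range' c n).reverse.map f).count v =
      ((Finset.Ico c (c + n)).filter fun j => f j = v).card := by
  induction n with
  | zero => simp
  | succ n ih =>
    rw [List.range'_concat, List.reverse_append, List.map_append, List.count_append, ih,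
      show c + (n + 1) = c + n + 1 from rfl, ← Finset.insert_Ico_right_eq_Ico_add_one (by omega),
      Finset.filter_insert]
    by_cases h : f (c + n) = v
    · rw [if_pos h, Finset.card_insert_of_notMem (by simp)]
      simp [h]
      omega
    · rw [if_neg h]
      simp [h]

theorem isBallot_iff_prefix (w : List ℕ) :
    IsBallot w ↔ ∀ u, u <+: w → ∀ k, u.count (k + 1 + 1) ≤ u.count (k + 1) := by
  constructor
  · intro h u hu k
    rw [List.prefix_iff_eq_take.1 hu]
    exact h (k + 1) _ (by omega)
  · intro h i k hi
    obtain ⟨i, rfl⟩ : ∃ j, i = j + 1 := ⟨i - 1, by omega⟩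
    exact h _ (List.take_prefix _ _) i

namespace YoungDiagram

theorem rowLen_eq_zero_of_colLen_le (μ : YoungDiagram) {i : ℕ} (hi : μ.colLen 0 ≤ i) :
    μ.rowLen i = 0 := by
  by_contra h
  have h1 : (i, 0) ∈ μ := mem_iff_lt_rowLen.2 (by omega)
  have h2 := mem_iff_lt_colLen.1 h1
  omega

theorem le_iff_rowLen_le (μ ν : YoungDiagram) : μ ≤ ν ↔ ∀ i, μ.rowLen i ≤ ν.rowLen i := by
  constructor
  · intro h i
    by_contra! hc
    have h1 : (i, ν.rowLen i) ∈ μ := mem_iff_lt_rowLen.2 hc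
    have h2 : (i, ν.rowLen i) ∈ ν := h h1
    exact absurd (mem_iff_lt_rowLen.1 h2) (by omega)
  · rintro h ⟨i, j⟩ hc
    have h1 : (i, j) ∈ μ := hc
    have h2 : (i, j) ∈ ν :=
      mem_iff_lt_rowLen.2 ((mem_iff_lt_rowLen.1 h1).trans_le (h i))
    exact h2

end YoungDiagram

namespace SkewTableau

variable {outer inner : YoungDiagram} (T : SkewTableau outer inner)

/-- The number of boxes in row `i` with entry `v`. -/
def rowCount (i v : ℕ) : ℕ :=
  ((Finset.Ico (inner.rowLen i) (outer.rowLen i)).filter fun j => T.entry i j = v).card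

/-- The column at which the entries exceeding `k` of row `i` start. -/
def rowEnd (i k : ℕ) : ℕ :=
  inner.rowLen i +
    ((Finset.Ico (inner.rowLen i) (outer.rowLen i)).filter fun j => T.entry i j ≤ k).card

theorem rowLen_le (T : SkewTableau outer inner) (i : ℕ) : inner.rowLen i ≤ outer.rowLen i :=
  (YoungDiagram.le_iff_rowLen_le _ _).1 T.inner_le i

theorem entry_mono {i j₁ j₂ : ℕ} (h : j₁ ≤ j₂) (h₁ : inner.rowLen i ≤ j₁)
    (h₂ : j₂ < outer.rowLen i) : T.entry i j₁ ≤ T.entry i j₂ := by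
  rcases eq_or_lt_of_le h with rfl | h
  · exact le_rfl
  · exact T.row_weak i j₁ j₂ h (by rw [YoungDiagram.mem_iff_lt_rowLen]; omega)
      (YoungDiagram.mem_iff_lt_rowLen.2 h₂)

/-- Rows increase weakly, so the boxes with entry at most `k` form an initial segment of the row. -/
theorem entry_le_iff {i j k : ℕ} (h₁ : inner.rowLen i ≤ j) (h₂ : j < outer.rowLen i) :
    T.entry i j ≤ k ↔ j < T.rowEnd i k := by
  rw [rowEnd]
  constructor
  · intro h
    have := Finset.card_le_card (show Finset.Ico (inner.rowLen i) (j + 1) ⊆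
        (Finset.Ico (inner.rowLen i) (outer.rowLen i)).filter fun j => T.entry i j ≤ k from ?_)
    · rw [Nat.card_Ico] at this
      omega
    · intro m hm
      rw [Finset.mem_Ico] at hm
      rw [Finset.mem_filter, Finset.mem_Ico]
      exact ⟨by omega, (T.entry_mono (by omega) hm.1 h₂).trans h⟩
  · intro h
    by_contra! hc
    have := Finset.card_le_card (show
        ((Finset.Ico (inner.rowLen i) (outer.rowLen i)).filter fun j => T.entry i j ≤ k) ⊆
        Finset.Ico (inner.rowLen i) j from ?_)
    · rw [Nat.card_Ico] at this
      omega
    · intro m hm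
      rw [Finset.mem_filter, Finset.mem_Ico] at hm
      rw [Finset.mem_Ico]
      refine ⟨hm.1.1, ?_⟩
      by_contra! hjm
      have := T.entry_mono hjm h₁ hm.1.2
      omega

theorem le_rowEnd (i k : ℕ) : inner.rowLen i ≤ T.rowEnd i k := Nat.le_add_right _ _

theorem rowEnd_le (i k : ℕ) : T.rowEnd i k ≤ outer.rowLen i := by
  have h1 := Finset.card_filter_le (Finset.Ico (inner.rowLen i) (outer.rowLen i))
    fun j => T.entry i j ≤ k
  have h2 := T.rowLen_le i
  rw [Nat.card_Ico] at h1
  rw [rowEnd]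
  omega

theorem rowEnd_zero (i : ℕ) : T.rowEnd i 0 = inner.rowLen i := by
  have h1 := T.le_rowEnd i 0
  by_contra hc
  have h2 := T.rowEnd_le i 0
  have h3 := (T.entry_le_iff le_rfl (show inner.rowLen i < outer.rowLen i by omega)).2
    (show inner.rowLen i < T.rowEnd i 0 by omega)
  have h4 := T.pos i (inner.rowLen i) (YoungDiagram.mem_iff_lt_rowLen.2 (by omega))
    (by rw [YoungDiagram.mem_iff_lt_rowLen]; omega)
  omega

theorem rowEnd_eq (i k : ℕ) (h : ∀ j, T.entry i j ≤ k) : T.rowEnd i k = outer.rowLen i := by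
  rw [rowEnd, Finset.filter_true_of_mem fun j _ => h j, Nat.card_Ico]
  have := T.rowLen_le i
  omega

theorem rowEnd_succ (i k : ℕ) : T.rowEnd i (k + 1) = T.rowEnd i k + T.rowCount i (k + 1) := by
  rw [rowEnd, rowEnd, rowCount, add_assoc, ← Finset.card_union_of_disjoint]
  · congr 2
    ext j
    simp only [Finset.mem_filter, Finset.mem_union]
    constructor
    · rintro ⟨h1, h2⟩
      rcases Nat.le_succ_iff.1 h2 with h2 | h2
      · exact Or.inl ⟨h1, h2⟩
      · exact Or.inr ⟨h1, h2⟩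
    · rintro (⟨h1, h2⟩ | ⟨h1, h2⟩)
      · exact ⟨h1, by omega⟩
      · exact ⟨h1, by omega⟩
  · refine Finset.disjoint_filter.2 fun j _ h1 h2 => ?_
    omega

/-- Otherwise an entry at most `k + 1` would lie directly below an entry exceeding `k`. -/
theorem rowEnd_succ_le (i k : ℕ) : T.rowEnd (i + 1) (k + 1) ≤ T.rowEnd i k := by
  by_contra! hc
  have h1 := T.le_rowEnd i k
  have h2 := inner.rowLen_anti i (i + 1) (by omega)
  have h3 := outer.rowLen_anti i (i + 1) (by omega)
  have h4 := T.rowEnd_le (i + 1) (k + 1)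
  have h5 := (T.entry_le_iff (k := k + 1) (show inner.rowLen (i + 1) ≤ T.rowEnd i k by omega)
    (by omega)).2 hc
  have h6 := (T.entry_le_iff (k := k) h1 (by omega)).not.2 (lt_irrefl _)
  have h7 := T.col_strict i (i + 1) (T.rowEnd i k) (by omega)
    (by rw [YoungDiagram.mem_iff_lt_rowLen]; omega)
    (YoungDiagram.mem_iff_lt_rowLen.2 (by omega))
  omega

theorem content_eq_sum (v : ℕ) {M : ℕ} (hM : outer.colLen 0 ≤ M) :
    T.content v = ∑ i ∈ Finset.range M, T.rowCount i v := by
  rw [content, Finset.card_eq_sum_card_fiberwise (f := Prod.fst) (t := Finset.range M)]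
  · refine Finset.sum_congr rfl fun i _ => ?_
    rw [rowCount]
    refine Finset.card_bij' (fun c _ => c.2) (fun j _ => (i, j)) ?_ ?_ ?_ ?_
    · rintro ⟨i', j⟩ h
      simp only [Finset.mem_filter, Finset.mem_sdiff, YoungDiagram.mem_cells,
        YoungDiagram.mem_iff_lt_rowLen] at h
      obtain ⟨⟨⟨h1, h2⟩, h3⟩, rfl⟩ := h
      rw [Finset.mem_filter, Finset.mem_Ico]
      exact ⟨by omega, h3⟩
    · intro j h
      rw [Finset.mem_filter, Finset.mem_Ico] at h
      simp only [Finset.mem_filter, Finset.mem_sdiff, YoungDiagram.mem_cells,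
        YoungDiagram.mem_iff_lt_rowLen]
      exact ⟨⟨⟨by omega, by omega⟩, h.2⟩, trivial⟩
    · rintro ⟨i', j⟩ h
      rw [Finset.mem_filter] at h
      obtain ⟨-, rfl⟩ := h
      rfl
    · exact fun j _ => rfl
  · rintro ⟨i, j⟩ h
    simp only [Finset.coe_filter, Set.mem_ofPred_eq, Finset.mem_sdiff, YoungDiagram.mem_cells] at h
    have h1 := YoungDiagram.mem_iff_lt_colLen.1
      (outer.up_left_mem le_rfl (Nat.zero_le j) h.1.1)
    simp only [Finset.coe_range, Set.mem_Iio]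
    omega

/-- The reading word of the rows with index less than `i`. -/
def wordAbove (i : ℕ) : List ℕ :=
  (List.range i).flatMap fun i =>
    (List.range' (inner.rowLen i) (outer.rowLen i - inner.rowLen i)).reverse.map (T.entry i)

/-- The reading word of the boxes of row `i` in the columns with index at least `c`. -/
def wordRight (i c : ℕ) : List ℕ :=
  (List.range' c (outer.rowLen i - c)).reverse.map (T.entry i)

theorem wordAbove_succ (i : ℕ) :
    T.wordAbove (i + 1) = T.wordAbove i ++ T.wordRight i (inner.rowLen i) := by
  simp [wordAbove, wordRight, List.range_succ]

theorem wordRight_prefix {i c : ℕ} (h₁ : inner.rowLen i ≤ c) (h₂ : c ≤ outer.rowLen i) :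
    T.wordRight i c <+: T.wordRight i (inner.rowLen i) := by
  refine ⟨(List.range' (inner.rowLen i) (c - inner.rowLen i)).reverse.map (T.entry i), ?_⟩
  rw [wordRight, wordRight, ← List.map_append, ← List.reverse_append]
  congr 2
  have h := List.range'_append (s := inner.rowLen i) (m := c - inner.rowLen i)
    (n := outer.rowLen i - c) (step := 1)
  rw [one_mul, show inner.rowLen i + (c - inner.rowLen i) = c by omega] at h
  rw [h]
  congr 1
  omega

theorem wordAbove_prefix (i : ℕ) : T.wordAbove i <+: T.rowWord := by
  have hmono : ∀ {i j : ℕ}, i ≤ j → T.wordAbove i <+: T.wordAbove j := by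
    intro i j hij
    induction j, hij using Nat.le_induction with
    | base => exact List.prefix_rfl
    | succ j _ ih => exact ih.trans ⟨_, (T.wordAbove_succ j).symm⟩
  rcases le_total i (outer.colLen 0) with hi | hi
  · exact hmono hi
  · have : T.wordAbove i = T.rowWord := by
      induction i, hi using Nat.le_induction with
      | base => rfl
      | succ i hi ih =>
        rw [wordAbove_succ, wordRight, outer.rowLen_eq_zero_of_colLen_le hi]
        simpa using ih
    rw [this]

theorem exists_of_prefix {u : List ℕ} {M : ℕ} (hu : u <+: T.wordAbove M) :
    ∃ i c, inner.rowLen i ≤ c ∧ c ≤ outer.rowLen i ∧ u = T.wordAbove i ++ T.wordRight i c := by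
  induction M with
  | zero =>
    refine ⟨0, outer.rowLen 0, T.rowLen_le 0, le_rfl, ?_⟩
    have : u = [] := List.prefix_nil.1 hu
    simp [this, wordAbove, wordRight]
  | succ M ih =>
    rw [wordAbove_succ] at hu
    rcases List.prefix_or_prefix_of_prefix hu (List.prefix_append _ _) with hu' | ⟨w, rfl⟩
    · exact ih hu'
    · have hw := (List.prefix_append_right_inj _).1 hu
      rw [List.prefix_iff_eq_take, wordRight, ← List.map_take, List.take_reverse,
        List.drop_range'] at hw
      simp only [List.length_range', mul_one] at hw
      have h1 := T.rowLen_le M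
      refine ⟨M, inner.rowLen M + (outer.rowLen M - inner.rowLen M - w.length), by omega, by omega,
        ?_⟩
      generalize w.length = n at hw ⊢
      rw [hw, wordRight, show outer.rowLen M - inner.rowLen M -
        (outer.rowLen M - inner.rowLen M - n) = outer.rowLen M -
          (inner.rowLen M + (outer.rowLen M - inner.rowLen M - n)) by omega]

theorem count_wordRight {i c : ℕ} (h₂ : c ≤ outer.rowLen i) (v : ℕ) :
    (T.wordRight i c).count v =
      ((Finset.Ico c (outer.rowLen i)).filter fun j => T.entry i j = v).card := by
  rw [wordRight, count_reverse_range', show c + (outer.rowLen i - c) = outer.rowLen i by omega]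

theorem count_wordAbove (i v : ℕ) :
    (T.wordAbove i).count v = ∑ j ∈ Finset.range i, T.rowCount j v := by
  induction i with
  | zero => rfl
  | succ i ih =>
    rw [wordAbove_succ, List.count_append, ih, Finset.sum_range_succ,
      T.count_wordRight (T.rowLen_le i), rowCount]

/-- Reading from right to left, a row shows all its `k + 2` before any of its `k + 1`. The worst
prefix therefore ends just after the letters `k + 2` of row `i`. -/
theorem isBallot_iff : IsBallot T.rowWord ↔ ∀ i k,
    ∑ j ∈ Finset.range (i + 1), T.rowCount j (k + 1 + 1) ≤
      ∑ j ∈ Finset.range i, T.rowCount j (k + 1) := by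
  rw [isBallot_iff_prefix]
  constructor
  · intro h i k
    have h1 := T.le_rowEnd i (k + 1)
    have h2 := T.rowEnd_le i (k + 1)
    have h3 : T.wordAbove i ++ T.wordRight i (T.rowEnd i (k + 1)) <+: T.rowWord := by
      refine List.IsPrefix.trans ?_ (T.wordAbove_prefix (i + 1))
      rw [wordAbove_succ]
      exact (List.prefix_append_right_inj _).2 (T.wordRight_prefix h1 h2)
    have h4 := h _ h3 k
    rw [List.count_append, List.count_append, count_wordAbove, count_wordAbove,
      T.count_wordRight h2, T.count_wordRight h2] at h4
    rw [Finset.sum_range_succ]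
    have h5 : T.rowCount i (k + 1 + 1) = ((Finset.Ico (T.rowEnd i (k + 1))
        (outer.rowLen i)).filter fun j => T.entry i j = k + 1 + 1).card := by
      rw [rowCount]
      congr 1
      ext j
      simp only [Finset.mem_filter, Finset.mem_Ico]
      constructor
      · rintro ⟨h6, h7⟩
        have h8 := T.entry_le_iff (k := k + 1) h6.1 h6.2
        exact ⟨by omega, h7⟩
      · rintro ⟨h6, h7⟩
        exact ⟨by omega, h7⟩
    have h6 : ((Finset.Ico (T.rowEnd i (k + 1)) (outer.rowLen i)).filter
        fun j => T.entry i j = k + 1).card = 0 := by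
      rw [Finset.card_eq_zero, Finset.filter_eq_empty_iff]
      intro j hj h7
      rw [Finset.mem_Ico] at hj
      have h8 := (T.entry_le_iff (k := k + 1) (h1.trans hj.1) hj.2).1 h7.le
      omega
    omega
  · intro h u hu k
    obtain ⟨i, c, h1, h2, rfl⟩ := T.exists_of_prefix (M := outer.colLen 0) hu
    rw [List.count_append, List.count_append, count_wordAbove, count_wordAbove,
      T.count_wordRight h2]
    have h3 := h i k
    rw [Finset.sum_range_succ] at h3
    have h4 : ((Finset.Ico c (outer.rowLen i)).filter fun j => T.entry i j = k + 1 + 1).card ≤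
        T.rowCount i (k + 1 + 1) :=
      Finset.card_le_card (Finset.filter_subset_filter _ (Finset.Ico_subset_Ico_left h1))
    omega

end SkewTableau

/-! ### Littlewood-Richardson tableaux and hives. -/

/-- The hive of a Littlewood-Richardson tableau. -/
theorem LRTableau.exists_hive {μ ν lam : YoungDiagram} (T : LRTableau μ ν lam) :
    ∃ H, LRHive μ.rowLen (fun _ => 0) lam.rowLen ν.rowLen H := by
  have hsum := fun i k => Finset.sum_range_succ (fun j => (T.1.rowEnd j k : ℤ)) i
  have hcount : ∀ i k, ∑ j ∈ Finset.range i, (T.1.rowEnd j (k + 1) : ℤ) =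
      ∑ j ∈ Finset.range i, (T.1.rowEnd j k : ℤ) +
        (∑ j ∈ Finset.range i, T.1.rowCount j (k + 1) : ℕ) := by
    intro i k
    push_cast
    rw [← Finset.sum_add_distrib]
    refine Finset.sum_congr rfl fun j _ => ?_
    rw [T.1.rowEnd_succ]
    push_cast
    rfl
  refine ⟨fun i k => ∑ j ∈ Finset.range i, (T.1.rowEnd j k : ℤ), fun i => ?_, fun k => ?_,
    ⟨ν.colLen 0, fun k hk i => ?_⟩, ⟨lam.colLen 0, fun i hi k => ?_⟩, fun i k => ?_, fun i k => ?_,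
    fun i k => ?_⟩
  · rw [hsum, T.1.rowEnd_zero]
  · simp
  · rw [hsum, T.1.rowEnd_eq i k fun j => (T.entry_le i j).trans hk]
  · rw [hcount, ← T.1.content_eq_sum (k + 1) hi, T.2.1 k]
  · have := T.1.rowEnd_succ i k
    rw [hsum, hsum]
    omega
  · have := T.1.rowEnd_succ_le i k
    rw [hsum (i + 1), hsum i (k + 1), hsum i k]
    omega
  · have := T.1.isBallot_iff.1 T.2.2 i k
    rw [hcount (i + 1) (k + 1), hcount i k]
    omega

namespace LRHive

variable {μ ν lam : YoungDiagram} {H : ℕ → ℕ → ℤ}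

/-- The column in which the letters exceeding `k` of row `i` start. -/
def rowEnd (H : ℕ → ℕ → ℤ) (i k : ℕ) : ℕ := (H (i + 1) k - H i k).toNat

theorem coe_rowEnd {p q P Q : ℕ → ℕ} (h : LRHive p q P Q H) (i k : ℕ) :
    (rowEnd H i k : ℤ) = H (i + 1) k - H i k := by
  have h1 := h.left i
  have h2 := h.row_le i (Nat.zero_le k)
  rw [rowEnd]
  omega

/-- The entries of the tableau of a hive. -/
noncomputable def entry (μ lam : YoungDiagram) (H : ℕ → ℕ → ℤ) (i j : ℕ) : ℕ :=
  if μ.rowLen i ≤ j ∧ j < lam.rowLen i then sInf {k | j < rowEnd H i k} else 0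

theorem entry_le_iff {q Q : ℕ → ℕ} (h : LRHive μ.rowLen q lam.rowLen Q H) {i j : ℕ}
    (hj : μ.rowLen i ≤ j ∧ j < lam.rowLen i) (k : ℕ) :
    entry μ lam H i j ≤ k ↔ j < rowEnd H i k := by
  rw [entry, if_pos hj]
  have hne : {k | j < rowEnd H i k}.Nonempty := by
    obtain ⟨N, hN⟩ := h.right
    refine ⟨N, ?_⟩
    have h1 := hN N le_rfl i
    have h2 := h.coe_rowEnd i N
    change j < rowEnd H i N
    omega
  constructor
  · intro hk
    have h1 : j < rowEnd H i _ := Nat.sInf_mem hne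
    have h2 := h.row_le i hk
    have h3 := h.coe_rowEnd i k
    have h4 := h.coe_rowEnd i (sInf {k | j < rowEnd H i k})
    omega
  · exact fun hk => Nat.sInf_le hk

theorem entry_pos {q Q : ℕ → ℕ} (h : LRHive μ.rowLen q lam.rowLen Q H) {i j : ℕ}
    (hj : μ.rowLen i ≤ j ∧ j < lam.rowLen i) : 0 < entry μ lam H i j := by
  by_contra hc
  have h1 := (h.entry_le_iff hj 0).1 (by omega)
  have h2 := h.coe_rowEnd i 0
  have h3 := h.left i
  omega

/-- The skew tableau of a hive. -/
noncomputable def skewTableau {q Q : ℕ → ℕ} (h : LRHive μ.rowLen q lam.rowLen Q H) :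
    SkewTableau lam μ where
  entry := entry μ lam H
  inner_le := by
    rw [YoungDiagram.le_iff_rowLen_le]
    intro i
    obtain ⟨N, hN⟩ := h.right
    have h1 := hN N le_rfl i
    have h2 := h.row_le i (Nat.zero_le N)
    have h3 := h.left i
    omega
  pos i j h1 h2 := by
    rw [YoungDiagram.mem_iff_lt_rowLen] at h1 h2
    exact h.entry_pos ⟨by omega, h1⟩
  row_weak i j₁ j₂ hj h1 h2 := by
    rw [YoungDiagram.mem_iff_lt_rowLen] at h1 h2
    rw [h.entry_le_iff ⟨by omega, by omega⟩]
    exact hj.trans ((h.entry_le_iff ⟨by omega, h2⟩ _).1 le_rfl)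
  col_strict i₁ i₂ j hi h1 h2 := by
    rw [YoungDiagram.mem_iff_lt_rowLen] at h1 h2
    have step : ∀ i, i₁ ≤ i → j < lam.rowLen (i + 1) →
        entry μ lam H i j < entry μ lam H (i + 1) j := by
      intro i hi hj
      have h3 := μ.rowLen_anti i₁ i hi
      have h4 := μ.rowLen_anti i (i + 1) (by omega)
      have h5 := lam.rowLen_anti i (i + 1) (by omega)
      have h6 := h.entry_pos (i := i + 1) (j := j) ⟨by omega, hj⟩
      obtain ⟨k, hk⟩ : ∃ k, entry μ lam H (i + 1) j = k + 1 := ⟨_, (Nat.succ_pred h6.ne').symm⟩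
      have h7 := (h.entry_le_iff (i := i + 1) ⟨by omega, hj⟩ (k + 1)).1 hk.le
      have h8 := h.column i k
      have h9 := h.coe_rowEnd i k
      have h10 := h.coe_rowEnd (i + 1) (k + 1)
      have h11 := (h.entry_le_iff (i := i) (j := j) ⟨by omega, by omega⟩ k).2 (by omega)
      omega
    induction i₂, hi using Nat.le_induction with
    | base => exact step i₁ le_rfl h2
    | succ i hi ih =>
      have h3 := lam.rowLen_anti i (i + 1) (by omega)
      exact (ih (by omega)).trans (step i (by omega) h2)
  zeros i j h1 := by
    simp only [YoungDiagram.mem_iff_lt_rowLen] at h1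
    rw [entry, if_neg (by omega)]

theorem rowEnd_skewTableau {q Q : ℕ → ℕ} (h : LRHive μ.rowLen q lam.rowLen Q H) (i k : ℕ) :
    (h.skewTableau.rowEnd i k : ℤ) = H (i + 1) k - H i k := by
  rw [← h.coe_rowEnd i k]
  have h1 := h.skewTableau.le_rowEnd i k
  have h2 := h.skewTableau.rowEnd_le i k
  have h3 : ∀ j, μ.rowLen i ≤ j → j < lam.rowLen i →
      (j < h.skewTableau.rowEnd i k ↔ j < rowEnd H i k) := fun j hj1 hj2 =>
    (h.skewTableau.entry_le_iff hj1 hj2).symm.trans (h.entry_le_iff ⟨hj1, hj2⟩ k)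
  have h4 : μ.rowLen i ≤ rowEnd H i k := by
    have := h.row_le i (Nat.zero_le k)
    have := h.left i
    have := h.coe_rowEnd i k
    omega
  have h5 : rowEnd H i k ≤ lam.rowLen i := by
    obtain ⟨N, hN⟩ := h.right
    have := h.row_le i (le_max_left k N)
    have := hN (max k N) (le_max_right k N) i
    have := h.coe_rowEnd i k
    omega
  rcases lt_trichotomy (h.skewTableau.rowEnd i k) (rowEnd H i k) with hlt | heq | hlt
  · exact absurd ((h3 _ h1 (by omega)).2 hlt) (lt_irrefl _)
  · rw [heq]
  · exact absurd ((h3 _ h4 (by omega)).1 hlt) (lt_irrefl _)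

theorem sum_rowCount_skewTableau {q Q : ℕ → ℕ} (h : LRHive μ.rowLen q lam.rowLen Q H) (i k : ℕ) :
    ((∑ j ∈ Finset.range i, h.skewTableau.rowCount j (k + 1) : ℕ) : ℤ) + q k =
      H i (k + 1) - H i k := by
  induction i with
  | zero => have := h.top k; simp; omega
  | succ i ih =>
    rw [Finset.sum_range_succ]
    have h1 := h.skewTableau.rowEnd_succ i k
    have h2 := h.rowEnd_skewTableau i k
    have h3 := h.rowEnd_skewTableau i (k + 1)
    omega

end LRHive

/-- Only positivity is needed, so the two constructions need not be shown inverse to each other. -/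
theorem lrCoeff_pos_iff {μ ν lam : YoungDiagram} :
    0 < lrCoeff μ ν lam ↔ ∃ H, LRHive μ.rowLen (fun _ => 0) lam.rowLen ν.rowLen H := by
  rw [lrCoeff, Nat.card_pos_iff]
  constructor
  · rintro ⟨⟨T⟩, -⟩
    exact T.exists_hive
  · rintro ⟨H, h⟩
    refine ⟨⟨h.skewTableau, fun k => ?_, ?_⟩, inferInstance⟩
    · obtain ⟨M, hM⟩ := h.bottom
      rw [h.skewTableau.content_eq_sum (k + 1) (le_max_left _ M)]
      have h1 := h.sum_rowCount_skewTableau (max (lam.colLen 0) M) k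
      have h2 := hM (max (lam.colLen 0) M) (le_max_right _ M) k
      omega
    · rw [SkewTableau.isBallot_iff]
      intro i k
      have h1 := h.sum_rowCount_skewTableau (i + 1) (k + 1)
      have h2 := h.sum_rowCount_skewTableau i k
      have h3 := h.ballot i k
      omega

/-! ### Adding and removing a box of a diagram. -/

namespace YoungDiagram

theorem exists_rowLen_eq {f : ℕ → ℕ} (hf : ∀ i, f (i + 1) ≤ f i) {N : ℕ} (hN : f N = 0) :
    ∃ μ : YoungDiagram, μ.rowLen = f := by
  have hanti : Antitone f := antitone_nat_of_succ_le hf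
  have hmem : ∀ c : ℕ × ℕ, c ∈ ((Finset.range N ×ˢ Finset.range (f 0)).filter
      fun c => c.2 < f c.1) ↔ c.2 < f c.1 := by
    rintro ⟨i, j⟩
    simp only [Finset.mem_filter, Finset.mem_product, Finset.mem_range, and_iff_right_iff_imp]
    intro h
    refine ⟨?_, h.trans_le (hanti (Nat.zero_le i))⟩
    by_contra! hc
    have := hanti hc
    omega
  refine ⟨⟨(Finset.range N ×ˢ Finset.range (f 0)).filter fun c => c.2 < f c.1, ?_⟩, ?_⟩
  · rintro ⟨i, j⟩ ⟨i', j'⟩ hle h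
    rw [Finset.mem_coe, hmem] at h ⊢
    have h1 : i' ≤ i := hle.1
    have h2 : j' ≤ j := hle.2
    have h3 := hanti h1
    dsimp only at h h3 ⊢
    omega
  · funext i
    refine eq_of_forall_lt_iff fun j => ?_
    rw [← mem_iff_lt_rowLen, ← mem_cells]
    exact hmem (i, j)

/-- The diagram `μ'` is obtained from `μ` by adding a box. -/
def IsAddBox (μ μ' : YoungDiagram) : Prop := ∃ t, μ'.rowLen = addBox μ.rowLen t

theorem exists_isAddBox {μ : YoungDiagram} {t : ℕ}
    (h : ∀ i, addBox μ.rowLen t (i + 1) ≤ addBox μ.rowLen t i) :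
    ∃ μ' : YoungDiagram, μ'.rowLen = addBox μ.rowLen t := by
  refine exists_rowLen_eq h (N := max (μ.colLen 0) (t + 1)) ?_
  rw [addBox, μ.rowLen_eq_zero_of_colLen_le (le_max_left _ _), if_neg (by omega)]

theorem exists_isAddBox_of_eq {μ : YoungDiagram} {f : ℕ → ℕ} {t : ℕ} (hμ : μ.rowLen = addBox f t)
    (h : ∀ i, f (i + 1) ≤ f i) : ∃ μ' : YoungDiagram, μ'.rowLen = f ∧ IsAddBox μ' μ := by
  have h1 := congrFun hμ (μ.colLen 0)
  rw [μ.rowLen_eq_zero_of_colLen_le le_rfl, addBox] at h1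
  obtain ⟨μ', hμ'⟩ := exists_rowLen_eq h (N := μ.colLen 0) (by omega)
  exact ⟨μ', hμ', t, hμ' ▸ hμ⟩

theorem rowLen_succ_le (μ : YoungDiagram) (i : ℕ) : μ.rowLen (i + 1) ≤ μ.rowLen i :=
  μ.rowLen_anti i (i + 1) (by omega)

theorem IsAddBox.cells_eq {μ μ' : YoungDiagram} (h : IsAddBox μ μ') :
    ∃ c, c ∉ μ.cells ∧ μ'.cells = insert c μ.cells := by
  obtain ⟨t, h⟩ := h
  refine ⟨(t, μ.rowLen t), ?_, ?_⟩
  · rw [mem_cells, mem_iff_lt_rowLen]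
    exact lt_irrefl _
  · ext ⟨i, j⟩
    rw [Finset.mem_insert, mem_cells, mem_cells, mem_iff_lt_rowLen, mem_iff_lt_rowLen, h, addBox,
      Prod.mk.injEq]
    by_cases hi : i = t
    · subst hi
      simp only [if_true, true_and]
      omega
    · simp [hi]

theorem IsAddBox.card_eq {μ μ' : YoungDiagram} (h : IsAddBox μ μ') : μ'.card = μ.card + 1 := by
  obtain ⟨c, hc, h⟩ := h.cells_eq
  rw [YoungDiagram.card, h, Finset.card_insert_of_notMem hc]

theorem IsAddBox.lt {μ μ' : YoungDiagram} (h : IsAddBox μ μ') : μ < μ' := by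
  obtain ⟨c, hc, h⟩ := h.cells_eq
  rw [← cells_ssubset_iff, h]
  exact Finset.ssubset_insert hc

/-- In the topmost row where `μ` is shorter than `ν`, the row above already agrees with `ν`, so a
box fits. -/
theorem exists_isAddBox_of_lt {μ ν : YoungDiagram} (h : μ < ν) :
    ∃ μ', IsAddBox μ μ' ∧ μ' ≤ ν := by
  have hle := (le_iff_rowLen_le _ _).1 h.le
  classical
  have hex : ∃ t, μ.rowLen t < ν.rowLen t := by
    by_contra! hc
    exact absurd ((le_iff_rowLen_le _ _).2 hc) h.not_ge
  have h1 := Nat.find_spec hex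
  have h2 : ∀ m, m < Nat.find hex → ¬ μ.rowLen m < ν.rowLen m := fun m => Nat.find_min hex
  generalize Nat.find hex = t at h1 h2
  obtain ⟨μ', hμ'⟩ := exists_isAddBox (μ := μ) (t := t) fun i => by
    have h3 := μ.rowLen_succ_le i
    have h4 := ν.rowLen_succ_le i
    simp only [addBox]
    by_cases hi : i + 1 = t
    · subst hi
      have := h2 i (by omega)
      simp only [if_true]
      omega
    · rw [if_neg hi]
      omega
  refine ⟨μ', ⟨t, hμ'⟩, (le_iff_rowLen_le _ _).2 fun i => ?_⟩
  rw [hμ', addBox]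
  have := hle i
  split_ifs with hi
  · subst hi; omega
  · omega

theorem exists_isAddBox_of_card_pos {μ : YoungDiagram} (h : 0 < μ.card) :
    ∃ μ', IsAddBox μ' μ := by
  obtain ⟨⟨i, j⟩, hc⟩ := Finset.card_pos.1 h
  have h1 : (i, j) ∈ μ := hc
  have h2 := mem_iff_lt_colLen.1 (μ.up_left_mem le_rfl (Nat.zero_le j) h1)
  -- Row `t` is the last nonempty row; its final box is always removable.
  obtain ⟨t, ht⟩ : ∃ t, μ.colLen 0 = t + 1 := ⟨μ.colLen 0 - 1, by omega⟩
  have h3 : 0 < μ.rowLen t := mem_iff_lt_rowLen.1 (mem_iff_lt_colLen.2 (by omega))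
  obtain ⟨μ', -, hμ'⟩ := exists_isAddBox_of_eq (μ := μ)
    (f := fun i => μ.rowLen i - if i = t then 1 else 0) (t := t) (funext fun i => by
      simp only [addBox]
      split_ifs with hi
      · subst hi; omega
      · omega) fun i => by
      have h4 := μ.rowLen_succ_le i
      by_cases hi : i = t
      · subst hi
        have h5 := μ.rowLen_eq_zero_of_colLen_le (show μ.colLen 0 ≤ i + 1 by omega)
        omega
      · rw [if_neg hi]
        omega
  exact ⟨μ', hμ'⟩

theorem rowLen_bot (i : ℕ) : (⊥ : YoungDiagram).rowLen i = 0 := by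
  by_contra h
  exact notMem_bot (i, 0) (mem_iff_lt_rowLen.2 (Nat.pos_of_ne_zero h))

end YoungDiagram

/-! ### One-box moves on positive Littlewood-Richardson coefficients. -/

open YoungDiagram

/-- Enlarging the inner shape, one loses a box of the content. -/
theorem lrCoeff_pos_add_inner {α α' β μ : YoungDiagram} (h : 0 < lrCoeff α β μ)
    (hα : IsAddBox α α') (hα' : α' ≤ μ) : ∃ β', IsAddBox β' β ∧ 0 < lrCoeff α' β' μ := by
  obtain ⟨H, hH⟩ := lrCoeff_pos_iff.1 h
  obtain ⟨s, hs⟩ := hα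
  have h1 := (le_iff_rowLen_le _ _).1 hα' s
  rw [hs] at h1
  simp only [addBox, if_true] at h1
  obtain ⟨t, Q, H', hQ, hH'⟩ := hH.add_left_bottom s
    (fun i => by simpa only [hs] using α'.rowLen_succ_le i) (by omega)
  obtain ⟨β', rfl, hβ'⟩ := exists_isAddBox_of_eq hQ hH'.bottom_antitone
  rw [← hs] at hH'
  exact ⟨β', hβ', lrCoeff_pos_iff.2 ⟨H', hH'⟩⟩

/-- Shrinking the inner shape, one gains a box of the content. -/
theorem lrCoeff_pos_remove_inner {α α' β μ : YoungDiagram} (h : 0 < lrCoeff α β μ)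
    (hα : IsAddBox α' α) : ∃ β', IsAddBox β β' ∧ 0 < lrCoeff α' β' μ := by
  obtain ⟨H, hH⟩ := lrCoeff_pos_iff.1 h
  obtain ⟨s, hs⟩ := hα
  rw [hs] at hH
  -- After transposition `α` is where the word starts, `β` the outer shape and `μ` the fixed end.
  obtain ⟨t, H', hH'⟩ := hH.transpose.remove_top s α'.rowLen_succ_le
  obtain ⟨β', hβ'⟩ := exists_isAddBox hH'.right_antitone
  rw [← hβ'] at hH'
  exact ⟨β', ⟨t, hβ'⟩, lrCoeff_pos_iff.2 ⟨_, hH'.transpose⟩⟩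

theorem lrCoeff_pos_remove_left {β β' γ lam : YoungDiagram} (h : 0 < lrCoeff β γ lam)
    (hβ : IsAddBox β' β) : ∃ lam', IsAddBox lam' lam ∧ 0 < lrCoeff β' γ lam' := by
  obtain ⟨H, hH⟩ := lrCoeff_pos_iff.1 h
  obtain ⟨s, hs⟩ := hβ
  rw [hs] at hH
  obtain ⟨t, Q, H', hQ, hH'⟩ := hH.transpose.remove_top_bottom s β'.rowLen_succ_le
  obtain ⟨lam', rfl, hlam'⟩ := exists_isAddBox_of_eq hQ hH'.bottom_antitone
  exact ⟨lam', hlam', lrCoeff_pos_iff.2 ⟨_, hH'.transpose⟩⟩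

/-- In the transposed hive `γ` is the outer shape over an empty inner one, and `lam` is the end of
the word. -/
theorem lrCoeff_pos_remove_right {β γ γ' lam : YoungDiagram} (h : 0 < lrCoeff β γ lam)
    (hγ : IsAddBox γ' γ) : ∃ lam', IsAddBox lam' lam ∧ 0 < lrCoeff β γ' lam' := by
  obtain ⟨H, hH⟩ := lrCoeff_pos_iff.1 h
  obtain ⟨s, hs⟩ := hγ
  rw [hs] at hH
  obtain ⟨t, Q, H', hQ, hH'⟩ := hH.transpose.remove_right_bottom s γ'.rowLen_succ_le
    (Nat.zero_le _)
  obtain ⟨lam', rfl, hlam'⟩ := exists_isAddBox_of_eq hQ hH'.bottom_antitone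
  exact ⟨lam', hlam', lrCoeff_pos_iff.2 ⟨_, hH'.transpose⟩⟩

theorem lrCoeff_pos_add_left {β β' γ lam : YoungDiagram} (h : 0 < lrCoeff β γ lam)
    (hβ : IsAddBox β β') : ∃ lam', IsAddBox lam lam' ∧ 0 < lrCoeff β' γ lam' := by
  obtain ⟨H, hH⟩ := lrCoeff_pos_iff.1 h
  obtain ⟨s, hs⟩ := hβ
  obtain ⟨t, H', hH'⟩ := hH.add_left s fun i => by simpa only [hs] using β'.rowLen_succ_le i
  obtain ⟨lam', hlam'⟩ := exists_isAddBox hH'.right_antitone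
  rw [← hlam', ← hs] at hH'
  exact ⟨lam', ⟨t, hlam'⟩, lrCoeff_pos_iff.2 ⟨_, hH'⟩⟩

theorem lrCoeff_pos_add_right {β γ γ' lam : YoungDiagram} (h : 0 < lrCoeff β γ lam)
    (hγ : IsAddBox γ γ') : ∃ lam', IsAddBox lam lam' ∧ 0 < lrCoeff β γ' lam' := by
  obtain ⟨H, hH⟩ := lrCoeff_pos_iff.1 h
  obtain ⟨s, hs⟩ := hγ
  obtain ⟨t, H', hH'⟩ := hH.add_bottom s fun i => by simpa only [hs] using γ'.rowLen_succ_le i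
  obtain ⟨lam', hlam'⟩ := exists_isAddBox hH'.right_antitone
  rw [← hlam', ← hs] at hH'
  exact ⟨lam', ⟨t, hlam'⟩, lrCoeff_pos_iff.2 ⟨_, hH'⟩⟩

/-- The product of two Schur functions contains the one indexed by the sum of the partitions. -/
theorem lrCoeff_pos_of_rowLen_eq_add {μ ν lam : YoungDiagram}
    (h : ∀ i, lam.rowLen i = μ.rowLen i + ν.rowLen i) : 0 < lrCoeff μ ν lam := by
  rw [lrCoeff_pos_iff]
  -- The hive of the tableau whose row `i` is filled with letters `i + 1`.
  set H : ℕ → ℕ → ℤ := fun i k =>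
    ∑ j ∈ Finset.range i, ((μ.rowLen j : ℤ) + if j < k then (ν.rowLen j : ℤ) else 0) with hH
  have hrow : ∀ i k, H (i + 1) k = H i k + (μ.rowLen i + if i < k then (ν.rowLen i : ℤ) else 0) :=
    fun i k => Finset.sum_range_succ _ i
  have hcol : ∀ i k, H i (k + 1) = H i k + if k < i then (ν.rowLen k : ℤ) else 0 := by
    intro i k
    induction i with
    | zero => simp [hH]
    | succ i ih =>
      rw [hrow, hrow, ih]
      rcases lt_trichotomy i k with hik | rfl | hik
      · simp only [hik, show i < k + 1 by omega, show ¬ k < i by omega, show ¬ k < i + 1 by omega,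
          if_true, if_false]
        omega
      · simp only [lt_irrefl, show i < i + 1 by omega, if_true, if_false]
        omega
      · simp only [hik, show ¬ i < k by omega, show ¬ i < k + 1 by omega, show k < i + 1 by omega,
          if_true, if_false]
        omega
  have hz : ∀ i, ν.colLen 0 ≤ i → ν.rowLen i = 0 := fun i => ν.rowLen_eq_zero_of_colLen_le
  refine ⟨H, fun i => ?_, fun k => ?_, ⟨ν.colLen 0, fun k hk i => ?_⟩,
    ⟨ν.colLen 0, fun i hi k => ?_⟩, fun i k => ?_, fun i k => ?_, fun i k => ?_⟩
  · rw [hrow]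
    simp
  · rw [hcol]
    simp
  · have := hz i
    rw [hrow, h]
    split_ifs <;> omega
  · have := hz k
    rw [hcol]
    split_ifs <;> omega
  · rw [hrow, hrow]
    split_ifs <;> omega
  · have h1 := μ.rowLen_succ_le i
    have h2 := ν.rowLen_succ_le i
    rw [hrow (i + 1), hrow i k]
    split_ifs <;> omega
  · have h1 := ν.rowLen_succ_le k
    rw [hcol (i + 1), hcol i k]
    split_ifs <;> omega

theorem lrCoeff_bot_left_pos (μ : YoungDiagram) : 0 < lrCoeff ⊥ μ μ :=
  lrCoeff_pos_of_rowLen_eq_add fun i => by rw [rowLen_bot, zero_add]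

/-! ### Newell-Littlewood numbers. -/

theorem newellLittlewood_pos_iff {μ ν lam : YoungDiagram} :
    0 < newellLittlewood μ ν lam ↔
      ∃ α β γ, 0 < lrCoeff α β μ ∧ 0 < lrCoeff α γ ν ∧ 0 < lrCoeff β γ lam := by
  rw [newellLittlewood, finsum_eq_sum _ (nlTerm_support_finite μ ν lam), Nat.pos_iff_ne_zero,
    Ne, Finset.sum_eq_zero_iff]
  simp only [Set.Finite.mem_toFinset, Function.mem_support, not_forall, nlTerm,
    Nat.pos_iff_ne_zero]
  constructor
  · rintro ⟨⟨α, β, γ⟩, h, -⟩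
    exact ⟨α, β, γ, by simpa [and_assoc] using h⟩
  · rintro ⟨α, β, γ, h⟩
    exact ⟨(α, β, γ), by simpa [and_assoc] using h, by simpa [and_assoc] using h⟩

theorem card_symmDiff_add (μ ν : YoungDiagram) :
    (symmDiff μ.cells ν.cells).card + 2 * (μ ⊓ ν).card = μ.card + ν.card := by
  have h1 := Finset.card_sdiff_add_card_inter μ.cells ν.cells
  have h2 := Finset.card_sdiff_add_card_inter ν.cells μ.cells
  rw [Finset.inter_comm] at h2
  have h3 : (symmDiff μ.cells ν.cells).card =
      (μ.cells \ ν.cells).card + (ν.cells \ μ.cells).card :=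
    Finset.card_union_of_disjoint disjoint_sdiff_sdiff
  rw [YoungDiagram.card, YoungDiagram.card, YoungDiagram.card, cells_inf]
  omega

theorem le_of_lrCoeff_pos {μ ν lam : YoungDiagram} (h : 0 < lrCoeff μ ν lam) : μ ≤ lam := by
  obtain ⟨⟨T⟩, -⟩ := Nat.card_pos_iff.1 h
  exact T.1.inner_le

theorem exists_newellLittlewood_pos_lt {μ ν lam : YoungDiagram} (h : 0 < newellLittlewood μ ν lam)
    (hcard : (symmDiff μ.cells ν.cells).card < lam.card) :
    ∃ lam', 0 < newellLittlewood μ ν lam' ∧ lam' < lam ∧ lam'.card + 2 = lam.card := by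
  obtain ⟨α, β, γ, h1, h2, h3⟩ := newellLittlewood_pos_iff.1 h
  have c1 := card_eq_of_lrCoeff_ne_zero h1.ne'
  have c2 := card_eq_of_lrCoeff_ne_zero h2.ne'
  have c3 := card_eq_of_lrCoeff_ne_zero h3.ne'
  have c4 := card_symmDiff_add μ ν
  -- Equality would force `lam.card` to equal the size of the symmetric difference.
  have hlt : α < μ ⊓ ν := by
    refine lt_of_le_of_ne (le_inf (le_of_lrCoeff_pos h1) (le_of_lrCoeff_pos h2)) ?_
    rintro rfl
    omega
  obtain ⟨α', hα, hα'⟩ := exists_isAddBox_of_lt hlt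
  obtain ⟨β', hβ, h1'⟩ := lrCoeff_pos_add_inner h1 hα (hα'.trans inf_le_left)
  obtain ⟨γ', hγ, h2'⟩ := lrCoeff_pos_add_inner h2 hα (hα'.trans inf_le_right)
  obtain ⟨lam₁, hlam₁, h4⟩ := lrCoeff_pos_remove_left h3 hβ
  obtain ⟨lam₂, hlam₂, h5⟩ := lrCoeff_pos_remove_right h4 hγ
  refine ⟨lam₂, newellLittlewood_pos_iff.2 ⟨α', β', γ', h1', h2', h5⟩, hlam₂.lt.trans hlam₁.lt, ?_⟩
  rw [hlam₁.card_eq, hlam₂.card_eq]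

theorem exists_newellLittlewood_pos_gt {μ ν lam : YoungDiagram} (h : 0 < newellLittlewood μ ν lam)
    (hcard : lam.card < μ.card + ν.card) :
    ∃ lam', 0 < newellLittlewood μ ν lam' ∧ lam < lam' ∧ lam'.card = lam.card + 2 := by
  obtain ⟨α, β, γ, h1, h2, h3⟩ := newellLittlewood_pos_iff.1 h
  have c1 := card_eq_of_lrCoeff_ne_zero h1.ne'
  have c2 := card_eq_of_lrCoeff_ne_zero h2.ne'
  have c3 := card_eq_of_lrCoeff_ne_zero h3.ne'
  obtain ⟨α', hα⟩ := exists_isAddBox_of_card_pos (show 0 < α.card by omega)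
  obtain ⟨β', hβ, h1'⟩ := lrCoeff_pos_remove_inner h1 hα
  obtain ⟨γ', hγ, h2'⟩ := lrCoeff_pos_remove_inner h2 hα
  obtain ⟨lam₁, hlam₁, h4⟩ := lrCoeff_pos_add_left h3 hβ
  obtain ⟨lam₂, hlam₂, h5⟩ := lrCoeff_pos_add_right h4 hγ
  refine ⟨lam₂, newellLittlewood_pos_iff.2 ⟨α', β', γ', h1', h2', h5⟩, hlam₁.lt.trans hlam₂.lt, ?_⟩
  rw [hlam₂.card_eq, hlam₁.card_eq]

theorem exists_newellLittlewood_pos_card_eq_add (μ ν : YoungDiagram) :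
    ∃ lam, lam.card = μ.card + ν.card ∧ 0 < newellLittlewood μ ν lam := by
  obtain ⟨lam, hlam⟩ := exists_rowLen_eq (f := fun i => μ.rowLen i + ν.rowLen i)
    (fun i => Nat.add_le_add (μ.rowLen_succ_le i) (ν.rowLen_succ_le i))
    (N := max (μ.colLen 0) (ν.colLen 0)) (by
      rw [μ.rowLen_eq_zero_of_colLen_le (le_max_left _ _),
        ν.rowLen_eq_zero_of_colLen_le (le_max_right _ _)])
  have h := lrCoeff_pos_of_rowLen_eq_add fun i => congrFun hlam i
  exact ⟨lam, (card_eq_of_lrCoeff_ne_zero h.ne').symm, newellLittlewood_pos_iff.2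
    ⟨⊥, μ, ν, lrCoeff_bot_left_pos μ, lrCoeff_bot_left_pos ν, h⟩⟩

theorem exists_newellLittlewood_pos_card_add_eq (μ ν : YoungDiagram) (m : ℕ)
    (hm : (symmDiff μ.cells ν.cells).card + 2 * m ≤ μ.card + ν.card) :
    ∃ lam : YoungDiagram, lam.card + 2 * m = μ.card + ν.card ∧ 0 < newellLittlewood μ ν lam := by
  induction m with
  | zero => exact exists_newellLittlewood_pos_card_eq_add μ ν
  | succ m ih =>
    obtain ⟨lam, h1, h2⟩ := ih (by omega)
    obtain ⟨lam', h3, -, h4⟩ := exists_newellLittlewood_pos_lt h2 (by omega)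
    exact ⟨lam', by omega, h3⟩

theorem theorem3p1 (μ ν : YoungDiagram) :
    (∀ k : ℕ,
      (∃ lam : YoungDiagram, lam.card = k ∧ 0 < newellLittlewood μ ν lam) ↔
        (k ≡ (symmDiff μ.cells ν.cells).card [MOD 2] ∧
          (symmDiff μ.cells ν.cells).card ≤ k ∧ k ≤ μ.card + ν.card)) ∧
    (∀ lam : YoungDiagram, 0 < newellLittlewood μ ν lam →
      (symmDiff μ.cells ν.cells).card < lam.card →
        ∃ lam' : YoungDiagram, 0 < newellLittlewood μ ν lam' ∧ lam' < lam ∧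
          lam'.card + 2 = lam.card) ∧
    (∀ lam : YoungDiagram, 0 < newellLittlewood μ ν lam →
      lam.card < μ.card + ν.card →
        ∃ lam' : YoungDiagram, 0 < newellLittlewood μ ν lam' ∧ lam < lam' ∧
          lam'.card = lam.card + 2) := by
  refine ⟨fun k => ?_, fun lam => exists_newellLittlewood_pos_lt,
    fun lam => exists_newellLittlewood_pos_gt⟩
  have c4 := card_symmDiff_add μ ν
  constructor
  · rintro ⟨lam, rfl, h⟩
    obtain ⟨α, β, γ, h1, h2, h3⟩ := newellLittlewood_pos_iff.1 h
    have c1 := card_eq_of_lrCoeff_ne_zero h1.ne'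
    have c2 := card_eq_of_lrCoeff_ne_zero h2.ne'
    have c3 := card_eq_of_lrCoeff_ne_zero h3.ne'
    have hle : α.card ≤ (μ ⊓ ν).card := Finset.card_le_card
      (cells_subset_iff.2 (le_inf (le_of_lrCoeff_pos h1) (le_of_lrCoeff_pos h2)))
    refine ⟨?_, by omega, by omega⟩
    unfold Nat.ModEq
    omega
  · rintro ⟨hmod, hle, hge⟩
    unfold Nat.ModEq at hmod
    -- The number of two-box descents from the maximal size; the division is exact by the parity
    -- condition.
    obtain ⟨lam, h1, h2⟩ := exists_newellLittlewood_pos_card_add_eq μ ν ((μ.card + ν.card - k) / 2)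
      (by omega)
    exact ⟨lam, by omega, h2⟩
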